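/- Let $I\subset\mathbb R$ be an open interval, $\rho:I\to(0,\infty)$ a smooth function, $\mathbb P^n$ a smooth Riemannian manifold with metric $g_{\mathbb P}$, and let $\overline M^{\,n+1}=I\times_\rho\mathbb P^n$ be the warped product, i.e. $I\times\mathbb P$ with the metric $dt^2+\rho(t)^2g_{\mathbb P}$. Let $M$ be a connected (immersed) smooth hypersurface of $\overline M$, let $\theta\in(0,\pi/2)$ and put $C=\tan\theta$. Then the following are equivalent. (a) $M$ is a constant angle hypersurface with angle $\theta$: it has a continuous unit normal field $\xi$ such that the angle between $\xi$ and $\partial_t$ equals $\theta$ at every point of $M$. (b) $M$ is locally the graph of a function $f=h\circ d$, where $d$ measures the distance to a fixed orientable hypersurface and $h^{-1}(s)=\int_{s_0}^s\frac{d\sigma}{C\rho(\sigma)}$. That is, every point of $M$ has an open neighbourhood $V$ in $M$ for which there are an open set $U\subset\mathbb P$, an orientable embedded hypersurface $L\subset\mathbb P$ and a number $s_0\in I$ such that: $U$ is disjoint from the closure of $L$; the Riemannian distance $d$ to $L$ is finite and differentiable on $U$; $d$ takes on $U$ only values in the interval $\left\{\int_{s_0}^s\frac{d\sigma}{C\rho(\sigma)}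 : s\in I\right\}$, on which $h$ denotes the inverse of $s\mapsto\int_{s_0}^s\frac{d\sigma}{C\rho(\sigma)}$; and $V$ is mapped bijectively by the immersion onto the graph $\{(h(d(x)),x) : x\in U\}$. -/

import Mathlib

open Set Bundle
open scoped Manifold ContDiff Topology

noncomputable section

/-! ### The warped product `I ×_ρ P`

`P` is an `n`-dimensional smooth Riemannian manifold.  The warped product `I ×_ρ P` is the open
subset `I × P` of the product manifold `ℝ × P`, with the metric `dt² + ρ(t)² g_P`.
The tangent space of `ℝ × P` at `(t, p)` is `ℝ × T_p P`. -/

section Warped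

variable {n : ℕ} {P : Type*} [TopologicalSpace P] [ChartedSpace (EuclideanSpace ℝ (Fin n)) P]

/-- The component along `∂_t` of a tangent vector of `ℝ × P`. -/
def timePart {x : ℝ × P} (v : TangentSpace (𝓘(ℝ, ℝ).prod (𝓡 n)) x) : ℝ :=
  (show ℝ × EuclideanSpace ℝ (Fin n) from v).1

/-- The component tangent to `P` of a tangent vector of `ℝ × P`. -/
def spacePart {x : ℝ × P} (v : TangentSpace (𝓘(ℝ, ℝ).prod (𝓡 n)) x) : TangentSpace (𝓡 n) x.2 :=
  (show ℝ × EuclideanSpace ℝ (Fin n) from v).2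

/-- The vector field `∂_t` on `ℝ × P`. -/
def dt (x : ℝ × P) : TangentSpace (𝓘(ℝ, ℝ).prod (𝓡 n)) x :=
  (show TangentSpace (𝓘(ℝ, ℝ).prod (𝓡 n)) x from ((1 : ℝ), (0 : EuclideanSpace ℝ (Fin n))))

/-- Sanity check: the two parts are the differentials of the two projections. -/
theorem timePart_eq_mfderiv [IsManifold (𝓡 n) 1 P] (x : ℝ × P)
    (v : TangentSpace (𝓘(ℝ, ℝ).prod (𝓡 n)) x) :
    mfderiv (𝓘(ℝ, ℝ).prod (𝓡 n)) 𝓘(ℝ, ℝ) Prod.fst x v = timePart v := by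
  rw [mfderiv_fst]; rfl

theorem spacePart_eq_mfderiv [IsManifold (𝓡 n) 1 P] (x : ℝ × P)
    (v : TangentSpace (𝓘(ℝ, ℝ).prod (𝓡 n)) x) :
    mfderiv (𝓘(ℝ, ℝ).prod (𝓡 n)) (𝓡 n) Prod.snd x v = spacePart v := by
  rw [mfderiv_snd]; rfl

variable [RiemannianBundle (fun p : P ↦ TangentSpace (𝓡 n) p)]

/-- The warped product metric `dt² + ρ(t)² g_P`. -/
def warpedInner (ρ : ℝ → ℝ) (x : ℝ × P) (v w : TangentSpace (𝓘(ℝ, ℝ).prod (𝓡 n)) x) : ℝ :=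
  timePart v * timePart w + ρ x.1 ^ 2 * inner ℝ (spacePart v) (spacePart w)

/-- The angle, in `[0, π]`, between two nonzero tangent vectors of the warped product. -/
def warpedAngle (ρ : ℝ → ℝ) (x : ℝ × P) (v w : TangentSpace (𝓘(ℝ, ℝ).prod (𝓡 n)) x) : ℝ :=
  Real.arccos (warpedInner ρ x v w /
    (Real.sqrt (warpedInner ρ x v v) * Real.sqrt (warpedInner ρ x w w)))

variable {M : Type*} [TopologicalSpace M] [ChartedSpace (EuclideanSpace ℝ (Fin n)) M]

/-- `F : M → I × P` is an (immersed, smooth) hypersurface of `I × P`; here `M` is an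
`n`-dimensional manifold, as is `P`. -/
structure IsImmersedHypersurface (I : Set ℝ) (F : M → ℝ × P) : Prop where
  mem : ∀ q, (F q).1 ∈ I
  smooth : ContMDiff (𝓡 n) (𝓘(ℝ, ℝ).prod (𝓡 n)) ∞ F
  injective_mfderiv : ∀ q, Function.Injective (mfderiv (𝓡 n) (𝓘(ℝ, ℝ).prod (𝓡 n)) F q)

/-- `ξ` is a (continuous) unit normal vector field along the hypersurface `F : M → I ×_ρ P`. -/
structure IsUnitNormalAlong [IsManifold (𝓡 n) ∞ P] (ρ : ℝ → ℝ) (F : M → ℝ × P)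
    (ξ : ∀ q : M, TangentSpace (𝓘(ℝ, ℝ).prod (𝓡 n)) (F q)) : Prop where
  continuous : Continuous
    (fun q ↦ (⟨F q, ξ q⟩ : TangentBundle (𝓘(ℝ, ℝ).prod (𝓡 n)) (ℝ × P)))
  unit : ∀ q, warpedInner ρ (F q) (ξ q) (ξ q) = 1
  normal : ∀ q (v : TangentSpace (𝓡 n) q),
    warpedInner ρ (F q) (ξ q) (mfderiv (𝓡 n) (𝓘(ℝ, ℝ).prod (𝓡 n)) F q v) = 0

/-- The hypersurface `F : M → I ×_ρ P` is orientable and, for a suitable choice of its unit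
normal field `ξ`, the angle between `∂_t` and `ξ` is everywhere equal to `θ`. -/
def IsConstantAngleHypersurface [IsManifold (𝓡 n) ∞ P] (ρ : ℝ → ℝ) (F : M → ℝ × P) (θ : ℝ) :
    Prop :=
  ∃ ξ : ∀ q : M, TangentSpace (𝓘(ℝ, ℝ).prod (𝓡 n)) (F q),
    IsUnitNormalAlong ρ F ξ ∧ ∀ q, warpedAngle ρ (F q) (dt (F q)) (ξ q) = θ

/-- `g` is a local defining function, on the open set `W`, of the subset `S` of `P`:
a smooth function on `W` with nonvanishing differential along its zero set `S ∩ W`. -/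
structure IsDefiningFunctionOn (S W : Set P) (g : P → ℝ) : Prop where
  isOpen : IsOpen W
  smooth : ContMDiffOn (𝓡 n) 𝓘(ℝ, ℝ) ∞ g W
  mem_iff : ∀ y ∈ W, y ∈ S ↔ g y = 0
  regular : ∀ y ∈ W, g y = 0 → mfderiv (𝓡 n) 𝓘(ℝ, ℝ) g y ≠ 0

/-- `S ⊆ P` is an (embedded, smooth) hypersurface which is orientable, that is, it carries a
continuous unit normal field `η`.  The tangent space of `S` at `x` is the kernel of the
differential at `x` of a local defining function. -/
def IsOrientableHypersurface [IsManifold (𝓡 n) ∞ P] (S : Set P) : Prop :=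
  ∃ η : ∀ x : P, TangentSpace (𝓡 n) x,
    ContinuousOn (fun x ↦ (⟨x, η x⟩ : TangentBundle (𝓡 n) P)) S ∧
    ∀ x ∈ S, ‖η x‖ = 1 ∧
      ∃ (W : Set P) (g : P → ℝ), x ∈ W ∧ IsDefiningFunctionOn (n := n) S W g ∧
        ∀ v : TangentSpace (𝓡 n) x, mfderiv (𝓡 n) 𝓘(ℝ, ℝ) g x v = 0 → inner ℝ (η x) v = 0

end Warped

/-- On the open set `U`, disjoint from the closure of `L`, the function `d` is differentiable and
is the (finite, positive) Riemannian distance to `L`. -/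
structure IsDistanceToOn {n : ℕ} {P : Type*} [PseudoEMetricSpace P]
    [ChartedSpace (EuclideanSpace ℝ (Fin n)) P] (d : P → ℝ) (L U : Set P) : Prop where
  isOpen : IsOpen U
  disjoint : Disjoint U (closure L)
  nonneg : ∀ x ∈ U, 0 ≤ d x
  eq_infEDist : ∀ x ∈ U, ENNReal.ofReal (d x) = Metric.infEDist x L
  differentiable : ∀ x ∈ U, MDifferentiableAt (𝓡 n) 𝓘(ℝ, ℝ) d x

/-- `h` is the inverse of the function `s ↦ ∫_{s₀}^s dσ / (C ρ(σ))`, defined for `s ∈ I`. -/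
def IsInverseProfile (I : Set ℝ) (ρ : ℝ → ℝ) (C s₀ : ℝ) (h : ℝ → ℝ) : Prop :=
  InvOn h (fun s ↦ ∫ σ in s₀..s, 1 / (C * ρ σ)) I
    ((fun s ↦ ∫ σ in s₀..s, 1 / (C * ρ σ)) '' I)

/-- Near every point, the hypersurface `F : M → I × P` is the graph `{(f(x), x) : x ∈ U}` of
`f = h ∘ d` over an open set `U ⊆ P`, where `d` is the distance to an orientable hypersurface
`L ⊆ P` and `h` is the inverse of `s ↦ ∫_{s₀}^s dσ / (C ρ(σ))`. -/
def IsLocallyDistanceGraph {n : ℕ} {P : Type*} [EMetricSpace P]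
    [ChartedSpace (EuclideanSpace ℝ (Fin n)) P] [IsManifold (𝓡 n) ∞ P]
    [RiemannianBundle (fun p : P ↦ TangentSpace (𝓡 n) p)]
    {M : Type*} [TopologicalSpace M]
    (I : Set ℝ) (ρ : ℝ → ℝ) (C : ℝ) (F : M → ℝ × P) : Prop :=
  ∀ q : M, ∃ (V : Set M) (U L : Set P) (s₀ : ℝ) (d : P → ℝ) (h : ℝ → ℝ),
    IsOpen V ∧ q ∈ V ∧
    IsOrientableHypersurface (n := n) L ∧
    IsDistanceToOn (n := n) d L U ∧
    s₀ ∈ I ∧ IsInverseProfile I ρ C s₀ h ∧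
    (∀ x ∈ U, d x ∈ (fun s ↦ ∫ σ in s₀..s, 1 / (C * ρ σ)) '' I) ∧
    BijOn F V {y : ℝ × P | y.2 ∈ U ∧ y.1 = (h ∘ d) y.2}

end

/-! Everything reduces to the eikonal equation `‖∇u‖ = 1` on `P`. Write a unit field as `ξ = cos θ
∂_t + X` with `X` tangent to `P`; unit length means `ρ ‖X‖ = sin θ`. Since `cos θ ≠ 0`, a tangent
vector of `M` killed by the projection to `P` has no time component, so the projection is a local
diffeomorphism and `M` is locally a graph `t = f(x)`. Let `G` be a primitive of `1 / (C ρ)` and `u =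
G ∘ f`. Normality of `ξ` reads `cos θ dt = -ρ² ⟨X, ·⟩` on `TM`, and with `C cos θ = sin θ` this
becomes `∇u = -(ρ / sin θ) X`, a unit vector. Conversely, a unit gradient yields a unit normal `ξ`
by solving this formula for `X`.

It remains to identify unit gradients with distances. If `‖∇u‖ = 1`, no path changes `u` by more
than its length, while integral curves of `∇u` realise equality, so `u + δ` is locally the distance
to `{u = -δ}` (`exists_isDistanceToOn`). In the other direction, a distance function grows by at
most the length of a path, so its gradient has norm at most one, and almost minimal paths to `L`
show that the norm is at least one. Only `C¹` integral curves and almost minimal paths are used, no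
geodesics.

In (b) the distance is only assumed differentiable. This already makes the projection of `M` an
immersion; the inverse function theorem then expresses `d` through the smooth hypersurface, so `d`
is smooth. -/

noncomputable section

/-! ### Riemannian gradient and its smoothness -/

section Gradient

variable {n : ℕ} {P : Type*} [TopologicalSpace P] [ChartedSpace (EuclideanSpace ℝ (Fin n)) P]
  [RiemannianBundle (fun p : P ↦ TangentSpace (𝓡 n) p)]

instance finiteDimensional_tangentSpace (x : P) : FiniteDimensional ℝ (TangentSpace (𝓡 n) x) :=
  inferInstanceAs (FiniteDimensional ℝ (EuclideanSpace ℝ (Fin n)))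

/-- Completeness of the fibres is what Riesz duality needs in `riemGrad`. -/
instance completeSpace_tangentSpace (x : P) : CompleteSpace (TangentSpace (𝓡 n) x) :=
  FiniteDimensional.complete ℝ _

variable (n) in
/-- The Riemannian gradient of a real function. -/
def riemGrad (u : P → ℝ) (x : P) : TangentSpace (𝓡 n) x :=
  (InnerProductSpace.toDual ℝ (TangentSpace (𝓡 n) x)).symm
    (show TangentSpace (𝓡 n) x →L[ℝ] ℝ from mfderiv (𝓡 n) 𝓘(ℝ, ℝ) u x)

theorem inner_riemGrad (u : P → ℝ) (x : P) (v : TangentSpace (𝓡 n) x) :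
    inner ℝ (riemGrad n u x) v = (mfderiv (𝓡 n) 𝓘(ℝ, ℝ) u x v : ℝ) :=
  InnerProductSpace.toDual_symm_apply

open ContinuousLinearMap in
/-- The gradient of a smooth function is smooth. -/
theorem contMDiffAt_riemGrad [IsManifold (𝓡 n) ∞ P]
    [IsContMDiffRiemannianBundle (𝓡 n) ∞ (EuclideanSpace ℝ (Fin n))
      (fun p : P ↦ TangentSpace (𝓡 n) p)]
    {u : P → ℝ} {x₀ : P} (hu : ContMDiffAt (𝓡 n) 𝓘(ℝ, ℝ) ∞ u x₀) :
    ContMDiffAt (𝓡 n) (𝓡 n).tangent ∞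
      (fun x ↦ (⟨x, riemGrad n u x⟩ : TangentBundle (𝓡 n) P)) x₀ := by
  obtain ⟨g, hg, hgi⟩ := IsContMDiffRiemannianBundle.exists_contMDiff (IB := 𝓡 n) (n := ∞)
    (F := EuclideanSpace ℝ (Fin n)) (E := fun p : P ↦ TangentSpace (𝓡 n) p)
  set e := trivializationAt (EuclideanSpace ℝ (Fin n)) (TangentSpace (𝓡 n) : P → Type _) x₀ with he
  have hD := hu.mfderiv_const (m := ∞) (by simp)
  have hG := (contMDiffAt_section _).1 (hg x₀)
  rw [contMDiffAt_section]
  -- `G` is the Gram matrix of the metric in the trivialization at `x₀`. There the gradient is `G⁻¹`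
  -- applied to the differential of `u`, and inversion of invertible linear maps is smooth.
  set G : P → EuclideanSpace ℝ (Fin n) →L[ℝ] EuclideanSpace ℝ (Fin n) →L[ℝ] ℝ := fun x ↦
    (trivializationAt (EuclideanSpace ℝ (Fin n) →L[ℝ] EuclideanSpace ℝ (Fin n) →L[ℝ] ℝ)
        (fun b : P ↦ TangentSpace (𝓡 n) b →L[ℝ] TangentSpace (𝓡 n) b →L[ℝ] ℝ) x₀
        ⟨x, g x⟩).2 with hGdef
  have hbase : e.baseSet ∈ 𝓝 x₀ :=
    e.open_baseSet.mem_nhds (FiberBundle.mem_baseSet_trivializationAt' x₀)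
  have hGval : ∀ x ∈ e.baseSet, ∀ a b : EuclideanSpace ℝ (Fin n),
      G x a b = inner ℝ (e.symmL ℝ x a) (e.symmL ℝ x b) := by
    intro x hx a b
    rw [hgi]
    simp only [hGdef, hom_trivializationAt_apply]
    rw [inCoordinates_apply_eq₂ hx hx (by simp)]
    have hs : ∀ c : EuclideanSpace ℝ (Fin n), e.symmL ℝ x c = e.symm x c := e.symmL_apply hx
    rw [hs a, hs b]
    exact LinearMap.congr_fun (Trivial.linearMapAt_trivialization ℝ P ℝ x) _
  have hinv : ∀ x ∈ e.baseSet, (G x).IsInvertible := by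
    intro x hx
    have hinj : Function.Injective (G x) := by
      rw [injective_iff_map_eq_zero]
      intro a ha
      have h0 := hGval x hx a a
      rw [ha] at h0
      have h1 : e.symmL ℝ x a = 0 := inner_self_eq_zero.1 h0.symm
      have h2 := e.continuousLinearMapAt_symmL (R := ℝ) hx a
      rw [h1, map_zero] at h2
      exact h2.symm
    have hfr : Module.finrank ℝ (EuclideanSpace ℝ (Fin n)) =
        Module.finrank ℝ (EuclideanSpace ℝ (Fin n) →L[ℝ] ℝ) :=
      (InnerProductSpace.toDual ℝ (EuclideanSpace ℝ (Fin n))).toLinearEquiv.finrank_eq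
    exact ⟨(LinearEquiv.ofInjectiveOfFinrankEq (G x).toLinearMap hinj hfr).toContinuousLinearEquiv,
      by ext; rfl⟩
  have hmain : ContMDiffAt (𝓡 n) 𝓘(ℝ, EuclideanSpace ℝ (Fin n)) ∞ (fun x ↦ (G x).inverse
      (inTangentCoordinates (𝓡 n) 𝓘(ℝ, ℝ) id u (mfderiv (𝓡 n) 𝓘(ℝ, ℝ) u) x₀ x)) x₀ := by
    refine ContMDiffAt.clm_apply ?_ hD
    exact ContMDiffAt.comp (g := ContinuousLinearMap.inverse) x₀
      ((hinv x₀ (mem_of_mem_nhds hbase)).contDiffAt_map_inverse.contMDiffAt) hG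
  refine hmain.congr_of_eventuallyEq ?_
  filter_upwards [hbase] with x hx
  symm
  rw [(hinv x hx).inverse_apply_eq]
  ext b
  have hback : e.symmL ℝ x (e ⟨x, riemGrad n u x⟩).2 = riemGrad n u x := by
    rw [Trivialization.symmL_apply (R := ℝ) e hx]
    exact e.symm_proj_apply ⟨x, riemGrad n u x⟩ hx
  rw [hGval x hx, hback, inner_riemGrad]
  have hux : u x ∈ (trivializationAt ℝ (TangentSpace 𝓘(ℝ, ℝ)) (u x₀)).baseSet := mem_univ _
  have h := inCoordinates_eq (E := TangentSpace (𝓡 n)) (E' := TangentSpace 𝓘(ℝ, ℝ)) (x₀ := x₀)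
    (y₀ := u x₀) (ϕ := mfderiv (𝓡 n) 𝓘(ℝ, ℝ) u x) hx hux
  refine (congrArg (fun f ↦ f b) h).trans ?_
  have hs : e.symmL ℝ x b = e.symm x b := e.symmL_apply hx b
  rw [hs]
  simp
  rfl

end Gradient

/-! ### Integral curves with a uniform existence time -/

section Flow

/-- A `C¹` vector field on a Banach space has, near any point, integral curves which are defined
for a uniform time, are of class `C¹` and stay close to the point. -/
theorem ContDiffAt.exists_uniform_integralCurve {E : Type*} [NormedAddCommGroup E]
    [NormedSpace ℝ E] [CompleteSpace E] {Y : E → E} {y₀ : E} (hY : ContDiffAt ℝ 1 Y y₀)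
    {N : Set E} (hN : N ∈ 𝓝 y₀) :
    ∃ ε > (0 : ℝ), ∀ᶠ y in 𝓝 y₀, ∃ α : ℝ → E, α 0 = y ∧
      ContDiffOn ℝ 1 α (Ioo (-ε) ε) ∧
      ∀ t ∈ Ioo (-ε) ε, α t ∈ N ∧ HasDerivAt α (Y (α t)) t := by
  obtain ⟨ε, hε, a, r, L, K, hr, hpl⟩ := IsPicardLindelof.of_contDiffAt_one hY
  obtain ⟨α, hα, hαc⟩ :=
    (hpl 0).exists_forall_mem_closedBall_eq_hasDerivWithinAt_continuousOn
  obtain ⟨S, hS, hYS⟩ := hY.contDiffOn le_rfl (by simp)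
  have hdom : Metric.closedBall y₀ (r : ℝ) ×ˢ Icc (0 - ε) (0 + ε) ∈ 𝓝 (y₀, (0 : ℝ)) :=
    prod_mem_nhds (Metric.closedBall_mem_nhds _ hr) (Icc_mem_nhds (by linarith) (by linarith))
  have h0 : α (y₀, 0) = y₀ := (hα y₀ (Metric.mem_closedBall_self r.2)).1
  -- Joint continuity of the flow at `(y₀, 0)` confines all nearby curves to `N ∩ S` for one common
  -- time.
  have hpre : α ⁻¹' (N ∩ S) ∈ 𝓝 (y₀, (0 : ℝ)) := by
    apply (hαc.continuousAt hdom).preimage_mem_nhds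
    rw [h0]
    exact Filter.inter_mem hN hS
  rw [nhds_prod_eq] at hpre hdom
  obtain ⟨A, hA, B, hB, hAB⟩ := Filter.mem_prod_iff.1 (Filter.inter_mem hpre hdom)
  obtain ⟨ε', hε', hball⟩ := Metric.mem_nhds_iff.1 hB
  refine ⟨ε', hε', ?_⟩
  filter_upwards [hA] with y hy
  have hmem : ∀ t ∈ Ioo (-ε') ε', (y, t) ∈ α ⁻¹' (N ∩ S) ∩
      Metric.closedBall y₀ (r : ℝ) ×ˢ Icc (0 - ε) (0 + ε) := fun t ht ↦
    hAB ⟨hy, hball (by simpa [Real.ball_eq_Ioo] using ht)⟩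
  have hyr : y ∈ Metric.closedBall y₀ (r : ℝ) := (hmem 0 (by simpa using hε')).2.1
  have hder : ∀ t ∈ Ioo (-ε') ε', HasDerivAt (fun s ↦ α (y, s)) (Y (α (y, t))) t := by
    intro t ht
    refine ((hα y hyr).2 t (hmem t ht).2.2).hasDerivAt ?_
    filter_upwards [isOpen_Ioo.mem_nhds ht] with s hs using (hmem s hs).2.2
  refine ⟨fun s ↦ α (y, s), (hα y hyr).1, ?_, fun t ht ↦ ⟨(hmem t ht).1.1, hder t ht⟩⟩
  have hdiff : DifferentiableOn ℝ (fun s ↦ α (y, s)) (Ioo (-ε') ε') :=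
    fun t ht ↦ (hder t ht).differentiableAt.differentiableWithinAt
  -- The derivative `Y ∘ α` is continuous because the curve stays in `S`, where `Y` is `C¹`.
  have : ContDiffOn ℝ (0 + 1) (fun s ↦ α (y, s)) (Ioo (-ε') ε') := by
    rw [contDiffOn_succ_iff_deriv_of_isOpen isOpen_Ioo]
    refine ⟨hdiff, by simp, ?_⟩
    rw [contDiffOn_zero]
    exact (hYS.continuousOn.comp hdiff.continuousOn fun t ht ↦ (hmem t ht).1.2).congr
      fun t ht ↦ (hder t ht).deriv
  simpa using this

variable {n : ℕ} {P : Type*} [TopologicalSpace P] [ChartedSpace (EuclideanSpace ℝ (Fin n)) P]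
  [IsManifold (𝓡 n) ∞ P]

/-- A `C¹` vector field on a manifold has, near any point, integral curves which are defined for a
uniform time, are of class `C¹` and stay close to the point. -/
theorem exists_uniform_mIntegralCurve {v : ∀ x : P, TangentSpace (𝓡 n) x} {x₀ : P}
    (hv : ContMDiffAt (𝓡 n) (𝓡 n).tangent 1
      (fun x ↦ (⟨x, v x⟩ : TangentBundle (𝓡 n) P)) x₀) {W : Set P} (hW : W ∈ 𝓝 x₀) :
    ∃ ε > (0 : ℝ), ∀ᶠ x in 𝓝 x₀, ∃ γ : ℝ → P, γ 0 = x ∧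
      ContMDiffOn 𝓘(ℝ, ℝ) (𝓡 n) 1 γ (Ioo (-ε) ε) ∧
      ∀ t ∈ Ioo (-ε) ε, γ t ∈ W ∧
        HasMFDerivAt 𝓘(ℝ, ℝ) (𝓡 n) γ t ((1 : ℝ →L[ℝ] ℝ).smulRight (v (γ t))) := by
  rw [contMDiffAt_iff] at hv
  obtain ⟨-, hv⟩ := hv
  have hN : (extChartAt (𝓡 n) x₀).target ∩ (extChartAt (𝓡 n) x₀).symm ⁻¹' W ∈
      𝓝 (extChartAt (𝓡 n) x₀ x₀) := by
    refine Filter.inter_mem (extChartAt_target_mem_nhds x₀) ?_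
    apply (continuousAt_extChartAt_symm x₀).preimage_mem_nhds
    simpa using hW
  obtain ⟨ε, hε, hα⟩ := (hv.contDiffAt
    (range_mem_nhds_isInteriorPoint BoundarylessManifold.isInteriorPoint)).snd
      |>.exists_uniform_integralCurve hN
  refine ⟨ε, hε, ?_⟩
  filter_upwards [(continuousAt_extChartAt (I := 𝓡 n) x₀).eventually hα,
    extChartAt_source_mem_nhds (I := 𝓡 n) x₀] with x hx hxs
  obtain ⟨f, hf0, hfc, hf⟩ := hx
  refine ⟨(extChartAt (𝓡 n) x₀).symm ∘ f, ?_, ?_, fun t ht ↦ ⟨(hf t ht).1.2, ?_⟩⟩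
  · rw [Function.comp_apply, hf0, PartialEquiv.left_inv _ hxs]
  · exact (contMDiffOn_extChartAt_symm x₀).comp hfc.contMDiffOn fun t ht ↦ (hf t ht).1.1
  -- The equation holds in the chart at `x₀`, while `HasMFDerivAt` is read in the chart at `γ t`;
  -- the two coordinate changes cancel.
  · let xₜ : P := (extChartAt (𝓡 n) x₀).symm (f t)
    have h : HasDerivAt f (x := t) <| fderivWithin ℝ
      (extChartAt (𝓡 n) x₀ ∘ (extChartAt (𝓡 n) xₜ).symm)
      (range (𝓡 n)) (extChartAt (𝓡 n) xₜ xₜ) (v xₜ) := (hf t ht).2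
    rw [← tangentCoordChange_def] at h
    obtain ⟨w, hw⟩ : ∃ w : EuclideanSpace ℝ (Fin n), w = v xₜ := ⟨_, rfl⟩
    replace h : HasDerivAt f (tangentCoordChange (𝓡 n) xₜ x₀ xₜ w) t := hw ▸ h
    have hf3' := (hf t ht).1.1
    have hft1 : xₜ ∈ (extChartAt (𝓡 n) x₀).source := (extChartAt (𝓡 n) x₀).map_target hf3'
    have hft2 := mem_extChartAt_source (I := 𝓡 n) xₜ
    have key : HasDerivAt ((extChartAt (𝓡 n) xₜ ∘ (extChartAt (𝓡 n) x₀).symm) ∘ f)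
        w t := by
      rw [← tangentCoordChange_self (I := 𝓡 n) (x := xₜ) (z := xₜ) (v := w) hft2,
        ← tangentCoordChange_comp (x := x₀) ⟨⟨hft2, hft1⟩, hft2⟩]
      apply HasFDerivAt.comp_hasDerivAt _ _ h
      apply HasFDerivWithinAt.hasFDerivAt (s := range (𝓡 n)) _ (by simp)
      rw [← (extChartAt (𝓡 n) x₀).right_inv hf3']
      exact hasFDerivWithinAt_tangentCoordChange ⟨hft1, hft2⟩
    refine ⟨(continuousAt_extChartAt_symm'' hf3').comp h.continuousAt, ?_⟩
    simp only [mfld_simps]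
    rw [hw] at key
    exact key.hasFDerivAt.hasFDerivWithinAt

end Flow

/-! ### Inverse function theorem on manifolds -/

section InverseFunction

variable {n : ℕ} {P : Type*} [TopologicalSpace P] [ChartedSpace (EuclideanSpace ℝ (Fin n)) P]
  [IsManifold (𝓡 n) ∞ P]
  {M : Type*} [TopologicalSpace M] [ChartedSpace (EuclideanSpace ℝ (Fin n)) M]
  [IsManifold (𝓡 n) ∞ M]

/-- The inverse function theorem for maps between manifolds of the same dimension. -/
theorem exists_openPartialHomeomorph_of_injective_mfderiv {p : M → P}
    (hp : ContMDiff (𝓡 n) (𝓡 n) ∞ p)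
    (hinj : ∀ q, Function.Injective (mfderiv (𝓡 n) (𝓡 n) p q)) (q : M) :
    ∃ e : OpenPartialHomeomorph M P, q ∈ e.source ∧ (∀ x ∈ e.source, e x = p x) ∧
      ContMDiffOn (𝓡 n) (𝓡 n) ∞ e.symm e.target := by
  set c := chartAt (EuclideanSpace ℝ (Fin n)) q with hc
  set c' := chartAt (EuclideanSpace ℝ (Fin n)) (p q) with hc'
  set f : EuclideanSpace ℝ (Fin n) → EuclideanSpace ℝ (Fin n) := c' ∘ p ∘ c.symm with hfdef
  have hopen : IsOpen (c.source ∩ p ⁻¹' c'.source) :=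
    c.open_source.inter (c'.open_source.preimage hp.continuous)
  have hcsm : ∀ y ∈ c.target, ContMDiffAt (𝓡 n) (𝓡 n) ∞ c.symm y := fun y hy ↦
    contMDiffOn_chart_symm.contMDiffAt (c.open_target.mem_nhds hy)
  have hfsm : ∀ x ∈ c.source ∩ p ⁻¹' c'.source, ContMDiffAt (𝓡 n) (𝓡 n) ∞ f (c x) := by
    intro x hx
    have hx2 : c.symm (c x) = x := c.left_inv hx.1
    refine ContMDiffAt.comp (c x) (I' := 𝓡 n) (g := c') ?_
      (ContMDiffAt.comp (c x) (I' := 𝓡 n) (g := p) (hp _) (hcsm _ (c.map_source hx.1)))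
    simp only [Function.comp_apply, hx2]
    exact contMDiffOn_chart.contMDiffAt (c'.open_source.mem_nhds hx.2)
  -- Invertibility is needed at every point and not only at `c q`: smoothness of the inverse at `y`
  -- uses it at the preimage of `y`.
  have hfder : ∀ x ∈ c.source ∩ p ⁻¹' c'.source,
      ∃ f' : EuclideanSpace ℝ (Fin n) ≃L[ℝ] EuclideanSpace ℝ (Fin n),
        HasFDerivAt f (f' : EuclideanSpace ℝ (Fin n) →L[ℝ] EuclideanSpace ℝ (Fin n)) (c x) := by
    intro x hx
    have hdiff : DifferentiableAt ℝ f (c x) :=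
      (hfsm x hx).contDiffAt.differentiableAt (by simp)
    have hx2 : c.symm (c x) = x := c.left_inv hx.1
    have hinj' : Function.Injective (fderiv ℝ f (c x)) := by
      have hmc : c.MDifferentiable (𝓡 n) (𝓡 n) := mdifferentiable_chart q
      have hmc' : c'.MDifferentiable (𝓡 n) (𝓡 n) := mdifferentiable_chart (p q)
      have h1 : MDifferentiableAt (𝓡 n) (𝓡 n) c.symm (c x) :=
        hmc.mdifferentiableAt_symm (c.map_source hx.1)
      have h2 : MDifferentiableAt (𝓡 n) (𝓡 n) p (c.symm (c x)) :=
        (hp _).mdifferentiableAt (by simp)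
      have h3 : MDifferentiableAt (𝓡 n) (𝓡 n) c' ((p ∘ c.symm) (c x)) :=
        hmc'.mdifferentiableAt (by simp only [Function.comp_apply, hx2]; exact hx.2)
      rw [← mfderiv_eq_fderiv, hfdef, mfderiv_comp (I' := 𝓡 n) (c x) h3 (h2.comp (c x) h1),
        mfderiv_comp (I' := 𝓡 n) (c x) h2 h1]
      refine (hmc'.mfderiv_injective ?_).comp ((hinj _).comp
        (hmc.symm.mfderiv_injective (c.map_source hx.1)))
      simp only [Function.comp_apply, hx2]
      exact hx.2
    refine ⟨(LinearEquiv.ofInjectiveEndo (fderiv ℝ f (c x)).toLinearMap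
      hinj').toContinuousLinearEquiv, ?_⟩
    convert hdiff.hasFDerivAt using 1
    ext v
    rfl
  have hq : q ∈ c.source ∩ p ⁻¹' c'.source := ⟨mem_chart_source _ q, mem_chart_source _ (p q)⟩
  obtain ⟨f₀, hf₀⟩ := hfder q hq
  have hstrict := (hfsm q hq).contDiffAt.hasStrictFDerivAt' hf₀ (by simp)
  set φ := hstrict.toOpenPartialHomeomorph f
  have hφ : ∀ y, φ y = f y := fun y ↦ rfl
  set e₀ : OpenPartialHomeomorph M P := (c.trans φ).trans c'.symm with he₀
  have he₀x : ∀ x ∈ c.source ∩ p ⁻¹' c'.source, e₀ x = p x := by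
    intro x hx
    change c'.symm (c' (p (c.symm (c x)))) = p x
    rw [c.left_inv hx.1, c'.left_inv hx.2]
  -- The restriction discards points whose image under `p` leaves the chart at `p q`, where `e₀`
  -- need not agree with `p`.
  refine ⟨e₀.restrOpen _ hopen, ?_, fun x hx ↦ he₀x x ?_, ?_⟩
  · rw [OpenPartialHomeomorph.restrOpen_source]
    refine ⟨?_, hq⟩
    simp only [he₀, OpenPartialHomeomorph.trans_source, mem_inter_iff, mem_preimage,
      OpenPartialHomeomorph.symm_source]
    refine ⟨⟨hq.1, hstrict.mem_toOpenPartialHomeomorph_source⟩, ?_⟩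
    change c' (p (c.symm (c q))) ∈ c'.target
    rw [c.left_inv hq.1]
    exact c'.map_source hq.2
  · rw [OpenPartialHomeomorph.restrOpen_source] at hx
    exact hx.2
  · intro y hy
    apply ContMDiffAt.contMDiffWithinAt
    set e := e₀.restrOpen _ hopen with he
    set x := e.symm y with hx
    have hxs : x ∈ e.source := e.map_target hy
    rw [he, OpenPartialHomeomorph.restrOpen_source] at hxs
    obtain ⟨f', hf'⟩ := hfder x hxs.2
    have hey : e₀ x = y := e.right_inv hy
    have hpy : p x = y := by rw [← he₀x x hxs.2, hey]
    have hxφ : c x ∈ φ.source := hxs.1.1.2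
    have hc'y : c' y = φ (c x) := by
      rw [hφ]
      change c' y = c' (p (c.symm (c x)))
      rw [c.left_inv hxs.2.1, hpy]
    have hφy : φ.symm (c' y) = c x := by rw [hc'y, φ.left_inv hxφ]
    have h1 : ContDiffAt ℝ ∞ φ.symm (c' y) := by
      refine φ.contDiffAt_symm (f₀' := f') ?_ ?_ ?_
      · rw [hc'y]; exact φ.map_source hxφ
      · rw [hφy]; exact hf'
      · rw [hφy]; exact (hfsm x hxs.2).contDiffAt
    have hyc' : y ∈ c'.source := hpy ▸ hxs.2.2
    change ContMDiffAt (𝓡 n) (𝓡 n) ∞ (c.symm ∘ φ.symm ∘ c') y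
    refine ContMDiffAt.comp y (I' := 𝓡 n) (g := c.symm) ?_
      (ContMDiffAt.comp y (I' := 𝓡 n) (g := φ.symm) h1.contMDiffAt
        (contMDiffOn_chart.contMDiffAt (c'.open_source.mem_nhds hyc')))
    simp only [Function.comp_apply, hφy]
    exact hcsm _ (c.map_source hxs.2.1)

end InverseFunction

/-! ### Distance functions and the eikonal equation -/

section Distance

open Manifold MeasureTheory

variable {n : ℕ} {P : Type*} [EMetricSpace P] [ChartedSpace (EuclideanSpace ℝ (Fin n)) P]
  [RiemannianBundle (fun p : P ↦ TangentSpace (𝓡 n) p)]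

/-- A function whose gradient has norm at most `k` varies along a path by at most `k` times the
length of the path. -/
theorem enorm_sub_le_mul_pathELength {u : P → ℝ} {W : Set P}
    (hu : ∀ y ∈ W, ContMDiffAt (𝓡 n) 𝓘(ℝ, ℝ) 1 u y) {k : NNReal}
    (hk : ∀ y ∈ W, ‖riemGrad n u y‖ₑ ≤ k) {γ : ℝ → P} {a b : ℝ} (hab : a ≤ b)
    (hγ : ContMDiffOn 𝓘(ℝ, ℝ) (𝓡 n) 1 γ (Icc a b)) (hW : ∀ t ∈ Icc a b, γ t ∈ W) :
    ‖u (γ b) - u (γ a)‖ₑ ≤ k * pathELength (𝓡 n) γ a b := by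
  rcases hab.eq_or_lt with rfl | hab'
  · simp
  have hC : ContMDiffOn 𝓘(ℝ, ℝ) 𝓘(ℝ, ℝ) 1 (u ∘ γ) (Icc a b) := fun t ht ↦
    (hu _ (hW t ht)).comp_contMDiffWithinAt t (hγ t ht)
  calc
    ‖(u ∘ γ) b - (u ∘ γ) a‖ₑ
    _ ≤ ∫⁻ t in Icc a b, ‖derivWithin (u ∘ γ) (Icc a b) t‖ₑ := by
      apply enorm_sub_le_lintegral_derivWithin_Icc_of_contDiffOn_Icc _ hab
      rwa [← contMDiffOn_iff_contDiffOn]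
    _ ≤ ∫⁻ t in Icc a b, k * ‖mfderivWithin 𝓘(ℝ, ℝ) (𝓡 n) γ (Icc a b) t 1‖ₑ := by
      apply setLIntegral_mono' measurableSet_Icc (fun t ht ↦ ?_)
      have hd : derivWithin (u ∘ γ) (Icc a b) t =
          inner ℝ (riemGrad n u (γ t)) (mfderivWithin 𝓘(ℝ, ℝ) (𝓡 n) γ (Icc a b) t 1) := by
        rw [inner_riemGrad, ← fderivWithin_derivWithin, ← mfderivWithin_eq_fderivWithin,
          mfderiv_comp_mfderivWithin (I' := 𝓡 n) t ((hu _ (hW t ht)).mdifferentiableAt one_ne_zero)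
          (hγ.mdifferentiableOn one_ne_zero t ht)
          (uniqueMDiffWithinAt_iff_uniqueDiffWithinAt.2 (uniqueDiffOn_Icc hab' _ ht))]
        rfl
      rw [hd]
      refine le_trans (b := ‖riemGrad n u (γ t)‖ₑ * ‖mfderivWithin 𝓘(ℝ, ℝ) (𝓡 n) γ (Icc a b) t 1‖ₑ)
        ?_ (by gcongr; exact hk _ (hW t ht))
      simp only [enorm]
      exact_mod_cast nnnorm_inner_le_nnnorm _ _
    _ = k * pathELength (𝓡 n) γ a b := by
      rw [lintegral_const_mul' _ _ ENNReal.coe_ne_top,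
          pathELength_eq_lintegral_mfderivWithin_Icc]

/-- A path of speed at most `k` on `[a, b]` has length at most `k (b - a)`. -/
theorem pathELength_le_mul {γ : ℝ → P} {a b : ℝ} {k : NNReal}
    (h : ∀ t ∈ Icc a b, ‖mfderiv 𝓘(ℝ, ℝ) (𝓡 n) γ t 1‖ₑ ≤ k) :
    pathELength (𝓡 n) γ a b ≤ k * ENNReal.ofReal (b - a) := by
  rw [pathELength_eq_lintegral_mfderiv_Icc]
  calc _ ≤ ∫⁻ t in Icc a b, (k : ENNReal) := setLIntegral_mono' measurableSet_Icc h
    _ = _ := by simp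

theorem edist_le_pathELength [IsRiemannianManifold (𝓡 n) P] {γ : ℝ → P} {a b : ℝ} (hab : a ≤ b)
    (hγ : ContMDiffOn 𝓘(ℝ, ℝ) (𝓡 n) 1 γ (Icc a b)) :
    edist (γ a) (γ b) ≤ pathELength (𝓡 n) γ a b := by
  rw [IsRiemannianManifold.out (I := 𝓡 n)]
  exact riemannianEDist_le_pathELength hγ rfl rfl hab

theorem exists_path_of_edist_lt [IsRiemannianManifold (𝓡 n) P] {x y : P} {r : ENNReal}
    (h : edist x y < r) : ∃ γ : ℝ → P, γ 0 = x ∧ γ 1 = y ∧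
      ContMDiffOn 𝓘(ℝ, ℝ) (𝓡 n) 1 γ (Icc 0 1) ∧ pathELength (𝓡 n) γ 0 1 < r := by
  rw [IsRiemannianManifold.out (I := 𝓡 n)] at h
  exact exists_lt_of_riemannianEDist_lt h

/-- Along a path with velocity `∇u`, the derivative of `u` is `‖∇u‖²`. -/
theorem hasDerivAt_comp_of_riemGrad {u : P → ℝ} {γ : ℝ → P} {t : ℝ}
    (hu : MDifferentiableAt (𝓡 n) 𝓘(ℝ, ℝ) u (γ t))
    (hγ : HasMFDerivAt 𝓘(ℝ, ℝ) (𝓡 n) γ t ((1 : ℝ →L[ℝ] ℝ).smulRight (riemGrad n u (γ t)))) :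
    HasDerivAt (u ∘ γ) (‖riemGrad n u (γ t)‖ ^ 2) t := by
  set w := riemGrad n u (γ t) with hw
  have h : HasFDerivAt (u ∘ γ) (show ℝ →L[ℝ] ℝ from
      (mfderiv (𝓡 n) 𝓘(ℝ, ℝ) u (γ t)).comp ((1 : ℝ →L[ℝ] ℝ).smulRight w)) t :=
    (hu.hasMFDerivAt.comp t hγ).hasFDerivAt
  refine h.hasDerivAt.congr_deriv ?_
  rw [← real_inner_self_eq_norm_sq]
  refine Eq.trans ?_ (inner_riemGrad u (γ t) w).symm
  exact congrArg (mfderiv (𝓡 n) 𝓘(ℝ, ℝ) u (γ t)) (one_smul ℝ w)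

theorem mfderiv_one_of_riemGrad {u : P → ℝ} {γ : ℝ → P} {t : ℝ}
    (hγ : HasMFDerivAt 𝓘(ℝ, ℝ) (𝓡 n) γ t ((1 : ℝ →L[ℝ] ℝ).smulRight (riemGrad n u (γ t)))) :
    mfderiv 𝓘(ℝ, ℝ) (𝓡 n) γ t 1 = riemGrad n u (γ t) := by
  rw [hγ.mfderiv]
  exact one_smul ℝ (riemGrad n u (γ t))

variable [IsManifold (𝓡 n) ∞ P]
  [IsContMDiffRiemannianBundle (𝓡 n) ∞ (EuclideanSpace ℝ (Fin n))
      (fun p : P ↦ TangentSpace (𝓡 n) p)]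

/-- Lets strict bounds on the gradient at a point persist in a neighbourhood. -/
theorem continuousAt_norm_riemGrad {u : P → ℝ} {x : P}
    (hu : ContMDiffAt (𝓡 n) 𝓘(ℝ, ℝ) ∞ u x) :
    ContinuousAt (fun y ↦ ‖riemGrad n u y‖) x := by
  have h := (contMDiffAt_riemGrad hu).inner_bundle (contMDiffAt_riemGrad hu)
  simp_rw [norm_eq_sqrt_real_inner]
  exact h.continuousAt.sqrt

variable [IsRiemannianManifold (𝓡 n) P]

/-- A smooth function with unit gradient is locally, up to a constant, the distance to one of its
level hypersurfaces. -/
theorem exists_isDistanceToOn {u : P → ℝ} {W : Set P} (hWo : IsOpen W) {x₀ : P} (hx₀ : x₀ ∈ W)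
    (hu : ContMDiffOn (𝓡 n) 𝓘(ℝ, ℝ) ∞ u W) (hgrad : ∀ y ∈ W, ‖riemGrad n u y‖ = 1)
    (hu0 : u x₀ = 0) {δ₀ : ℝ} (hδ₀ : 0 < δ₀) :
    ∃ δ ∈ Ioo 0 δ₀, ∃ U L : Set P, x₀ ∈ U ∧ U ⊆ W ∧ IsOrientableHypersurface (n := n) L ∧
      IsDistanceToOn (n := n) (fun x ↦ u x + δ) L U := by
  have hua : ∀ y ∈ W, ContMDiffAt (𝓡 n) 𝓘(ℝ, ℝ) ∞ u y := fun y hy ↦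
    hu.contMDiffAt (hWo.mem_nhds hy)
  obtain ⟨ε, hε, hflow⟩ := exists_uniform_mIntegralCurve
    ((contMDiffAt_riemGrad (hua x₀ hx₀)).of_le (by simp)) (hWo.mem_nhds hx₀)
  obtain ⟨N, hN, hNo, hx₀N⟩ := eventually_nhds_iff.1 hflow
  obtain ⟨r, hr, hrW⟩ := EMetric.mem_nhds_iff.1 (hWo.mem_nhds hx₀)
  obtain ⟨r', hr'0, hr'⟩ : ∃ r' : ℝ, 0 < r' ∧ ENNReal.ofReal r' < r := by
    obtain ⟨q, hq0, hq⟩ := ENNReal.lt_iff_exists_real_btwn.1 hr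
    refine ⟨q, ?_, hq.2⟩
    simpa using hq.1
  -- On `U` below, `u + δ` lies between `δ / 2` and `3δ / 2`. The bound `ε / 2` lets the flow run
  -- for that time. The bound `r' / 2` keeps paths of that length from `U` inside `W`, as `3δ / 2 +
  -- δ / 2 = 2δ < r'`.
  obtain ⟨δ, hδ0, hδ⟩ : ∃ δ : ℝ, 0 < δ ∧ δ < min δ₀ (min (ε / 2) (r' / 2)) :=
    exists_between (by positivity)
  rw [lt_min_iff, lt_min_iff] at hδ
  obtain ⟨hδ1, hδ2, hδ3⟩ := hδ
  set U : Set P := (N ∩ Metric.eball x₀ (ENNReal.ofReal (δ / 2))) ∩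
    (W ∩ u ⁻¹' Ioo (-(δ / 2)) (δ / 2)) with hU
  set L : Set P := {y | y ∈ W ∧ u y + δ = 0} with hL
  have hUo : IsOpen U := (hNo.inter Metric.isOpen_eball).inter
    (hu.continuousOn.isOpen_inter_preimage hWo isOpen_Ioo)
  refine ⟨δ, ⟨hδ0, hδ1⟩, U, L, ⟨⟨hx₀N, Metric.mem_eball_self (by simpa using hδ0)⟩, hx₀, ?_⟩,
    fun x hx ↦ hx.2.1, ⟨riemGrad n u, ?_, ?_⟩, hUo, ?_, ?_, ?_, ?_⟩
  · simp [hu0, hδ0]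
  · exact fun y hy ↦ (contMDiffAt_riemGrad (hua y hy.1)).continuousAt.continuousWithinAt
  · intro y hy
    have hmf : ∀ z ∈ W,
        mfderiv (𝓡 n) 𝓘(ℝ, ℝ) (fun x ↦ u x + δ) z = mfderiv (𝓡 n) 𝓘(ℝ, ℝ) u z := fun z hz ↦
      (((hua z hz).mdifferentiableAt (by simp)).hasMFDerivAt.add
        (hasMFDerivAt_const δ z)).mfderiv.trans (add_zero _)
    refine ⟨hgrad y hy.1, W, fun x ↦ u x + δ, hy.1, ⟨hWo, ?_, ?_, ?_⟩, ?_⟩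
    · exact hu.add contMDiffOn_const
    · exact fun z hz ↦ ⟨fun h ↦ h.2, fun h ↦ ⟨hz, h⟩⟩
    · intro z hz _ h0
      have h1 := inner_riemGrad u z (riemGrad n u z)
      rw [← hmf z hz, h0, real_inner_self_eq_norm_sq, hgrad z hz] at h1
      exact one_ne_zero (α := ℝ) ((one_pow 2).symm.trans (h1.trans rfl))
    · intro v hv
      rw [hmf y hy.1] at hv
      rw [inner_riemGrad]
      exact hv
  · apply Disjoint.closure_right _ hUo
    rw [Set.disjoint_left]
    rintro y hyU ⟨-, hy⟩
    have := hyU.2.2.1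
    linarith
  · intro x hx
    have := hx.2.2.1
    linarith
  · intro x hx
    have hx1 := hx.2.2.1
    have hx2 := hx.2.2.2
    apply le_antisymm
    -- A path from `x` to `L` shorter than `u x + δ` would stay in `W`, yet `u` has to drop by `u x
    -- + δ` along it, more than its length allows.
    · rw [Metric.le_infEDist]
      intro y hy
      by_contra! hlt
      obtain ⟨γ, hγ0, hγ1, hγ, hlen⟩ := exists_path_of_edist_lt (n := n) hlt
      have hmem : ∀ t ∈ Icc (0 : ℝ) 1, γ t ∈ W := by
        intro t ht
        apply hrW
        rw [Metric.mem_eball]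
        have h1 : edist x (γ t) ≤ ENNReal.ofReal (u x + δ) := by
          nth_rewrite 1 [← hγ0]
          refine (edist_le_pathELength (n := n) ht.1 (hγ.mono (Icc_subset_Icc_right ht.2))).trans
            ((pathELength_mono le_rfl ht.2).trans hlen.le)
        calc edist (γ t) x₀ ≤ edist x (γ t) + edist x x₀ := by
              rw [edist_comm x]; exact edist_triangle _ _ _
          _ ≤ ENNReal.ofReal (u x + δ) + ENNReal.ofReal (δ / 2) :=
              add_le_add h1 (Metric.mem_eball.1 hx.1.2).le
          _ = ENNReal.ofReal (u x + δ + δ / 2) := by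
              rw [ENNReal.ofReal_add (p := u x + δ) (q := δ / 2) (by linarith) (by linarith)]
          _ ≤ ENNReal.ofReal r' := ENNReal.ofReal_le_ofReal (by linarith)
          _ < r := hr'
      have := enorm_sub_le_mul_pathELength (k := 1)
        (fun y hy ↦ (hua y hy).of_le (by simp)) (fun y hy ↦ by
          rw [← ofReal_norm, hgrad y hy]; simp) zero_le_one hγ hmem
      rw [hγ0, hγ1, ENNReal.coe_one, one_mul] at this
      have h2 : ‖u y - u x‖ₑ = ENNReal.ofReal (u x + δ) := by
        rw [show u y - u x = -(u x + δ) by linarith [hy.2], enorm_neg,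
          Real.enorm_of_nonneg (by linarith)]
      rw [h2] at this
      exact absurd (this.trans_lt hlen) (lt_irrefl _)
    -- Following `∇u` backwards for time `T` lowers `u` at unit rate and unit speed: this path ends
    -- on `L` and has length at most `T`.
    · obtain ⟨γ, hγ0, hγ, hγt⟩ := hN x hx.1.1
      set T := u x + δ with hT
      have hsub : Icc (-T) 0 ⊆ Ioo (-ε) ε := fun t ht ↦ ⟨by linarith [ht.1], by linarith [ht.2]⟩
      have hder : ∀ t ∈ Ioo (-ε) ε, HasDerivAt (u ∘ γ) 1 t := by
        intro t ht
        have := hasDerivAt_comp_of_riemGrad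
          ((hua _ (hγt t ht).1).mdifferentiableAt (by simp)) (hγt t ht).2
        rwa [hgrad _ (hγt t ht).1, one_pow] at this
      have huT : u (γ (-T)) = -δ := by
        obtain ⟨c, hc, hc'⟩ := exists_hasDerivAt_eq_slope (u ∘ γ) (fun _ ↦ 1)
          (show -T < 0 by linarith)
          (fun t ht ↦ (hder t (hsub ht)).continuousAt.continuousWithinAt)
          (fun t ht ↦ hder t (hsub (Ioo_subset_Icc_self ht)))
        have hT0 : 0 < T := by linarith
        simp only [Function.comp_apply, hγ0] at hc'
        rw [eq_div_iff (by linarith)] at hc'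
        linarith
      have hmemL : γ (-T) ∈ L :=
        ⟨(hγt _ (hsub ⟨le_rfl, by linarith⟩)).1, by rw [huT]; simp⟩
      refine (Metric.infEDist_le_edist_of_mem hmemL).trans ?_
      rw [edist_comm, ← hγ0]
      refine (edist_le_pathELength (n := n) (by linarith) (hγ.mono hsub)).trans ?_
      refine (pathELength_le_mul (k := 1) fun t ht ↦ ?_).trans ?_
      · rw [mfderiv_one_of_riemGrad (hγt t (hsub ht)).2, ← ofReal_norm,
          hgrad _ (hγt t (hsub ht)).1]
        simp
      · simp
  · intro x hx
    exact ((hua x hx.2.1).mdifferentiableAt (by simp)).add mdifferentiableAt_const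

/-- The gradient of a smooth distance function has norm at most one. -/
theorem norm_riemGrad_le_one_of_isDistanceToOn {d : P → ℝ} {L U : Set P}
    (hd : IsDistanceToOn (n := n) d L U) {x : P} (hx : x ∈ U)
    (hs : ContMDiffAt (𝓡 n) 𝓘(ℝ, ℝ) ∞ d x) : ‖riemGrad n d x‖ ≤ 1 := by
  by_contra! hgt
  -- Such `k` exists because the norm exceeds one. Along the flow of `∇d` the speed stays below `k`
  -- while `d` grows faster than `k`, which a distance cannot do.
  obtain ⟨k, hk1, hk2⟩ : ∃ k, ‖riemGrad n d x‖ < k ∧ k < ‖riemGrad n d x‖ ^ 2 :=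
    exists_between (by nlinarith)
  have hc := continuousAt_norm_riemGrad hs
  have hW : {y | y ∈ U ∧ ‖riemGrad n d y‖ < k ∧ k < ‖riemGrad n d y‖ ^ 2} ∈ 𝓝 x := by
    filter_upwards [hd.isOpen.mem_nhds hx, hc.eventually_lt_const hk1,
      (hc.pow 2).eventually_const_lt hk2] with y h1 h2 h3 using ⟨h1, h2, h3⟩
  obtain ⟨ε, hε, hflow⟩ := exists_uniform_mIntegralCurve
    ((contMDiffAt_riemGrad hs).of_le (by simp)) hW
  obtain ⟨γ, hγ0, hγ, hγt⟩ := hflow.self_of_nhds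
  have hsub : Icc 0 (ε / 2) ⊆ Ioo (-ε) ε := fun t ht ↦ ⟨by linarith [ht.1], by linarith [ht.2]⟩
  have hder : ∀ t ∈ Ioo (-ε) ε, HasDerivAt (d ∘ γ) (‖riemGrad n d (γ t)‖ ^ 2) t := fun t ht ↦
    hasDerivAt_comp_of_riemGrad (hd.differentiable _ (hγt t ht).1.1) (hγt t ht).2
  obtain ⟨c, hc, hc'⟩ := exists_hasDerivAt_eq_slope (d ∘ γ) _
    (show 0 < ε / 2 by linarith)
    (fun t ht ↦ (hder t (hsub ht)).continuousAt.continuousWithinAt)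
    (fun t ht ↦ hder t (hsub (Ioo_subset_Icc_self ht)))
  have hck := (hγt c (hsub (Ioo_subset_Icc_self hc))).1.2.2
  rw [hc', lt_div_iff₀ (by linarith)] at hck
  have hz := (hγt (ε / 2) (hsub ⟨by linarith, le_rfl⟩)).1.1
  have hk0 : 0 ≤ k := by linarith
  have hlen : pathELength (𝓡 n) γ 0 (ε / 2) ≤ ENNReal.ofReal (k * (ε / 2)) := by
    refine (pathELength_le_mul (k := k.toNNReal) fun t ht ↦ ?_).trans ?_
    · rw [mfderiv_one_of_riemGrad (hγt t (hsub ht)).2, ← ofReal_norm]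
      exact ENNReal.ofReal_le_ofReal (hγt t (hsub ht)).1.2.1.le
    · rw [ENNReal.ofReal_mul hk0, sub_zero]
      rfl
  have hle : ENNReal.ofReal (d (γ (ε / 2))) ≤ ENNReal.ofReal (d x + k * (ε / 2)) := by
    rw [hd.eq_infEDist _ hz, ENNReal.ofReal_add (hd.nonneg _ hx) (by positivity),
      hd.eq_infEDist _ hx]
    refine (Metric.infEDist_le_infEDist_add_edist (y := x)).trans ?_
    gcongr
    rw [edist_comm]
    nth_rewrite 1 [← hγ0]
    exact (edist_le_pathELength (n := n) (by linarith) (hγ.mono hsub)).trans hlen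
  rw [ENNReal.ofReal_le_ofReal_iff (by have := hd.nonneg _ hx; positivity)] at hle
  simp only [Function.comp_apply, hγ0] at hck
  linarith

/-- The gradient of a smooth distance function has norm at least one. -/
theorem one_le_norm_riemGrad_of_isDistanceToOn {d : P → ℝ} {L U : Set P}
    (hd : IsDistanceToOn (n := n) d L U) {x : P} (hx : x ∈ U)
    (hs : ContMDiffAt (𝓡 n) 𝓘(ℝ, ℝ) ∞ d x) : 1 ≤ ‖riemGrad n d x‖ := by
  by_contra! hlt
  obtain ⟨k, hk1, hk2⟩ := exists_between hlt
  have hk0 : 0 ≤ k := (norm_nonneg _).trans hk1.le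
  set W : Set P := {y | y ∈ U ∧ ContMDiffAt (𝓡 n) 𝓘(ℝ, ℝ) 1 d y ∧ ‖riemGrad n d y‖ < k} with hWdef
  have hW : W ∈ 𝓝 x := by
    filter_upwards [hd.isOpen.mem_nhds hx,
      (contMDiffAt_iff_contMDiffAt_nhds (by simp)).1 (ContMDiffAt.of_le (m := 1) hs (by simp)),
      (continuousAt_norm_riemGrad hs).eventually_lt_const hk1] with y h1 h2 h3 using ⟨h1, h2, h3⟩
  obtain ⟨R, hR, hRW⟩ := EMetric.mem_nhds_iff.1 hW
  obtain ⟨r, hr0, hr⟩ := ENNReal.lt_iff_exists_real_btwn.1 hR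
  have hr1 : 0 < r := by simpa using hr.1
  have hcl : ∀ z, edist x z ≤ ENNReal.ofReal r → z ∈ W := fun z hz ↦
    hRW (by rw [Metric.mem_eball, edist_comm]; exact hz.trans_lt hr.2)
  have hdx := hd.nonneg _ hx
  -- The slack `(1 - k) * r` is what a path saves at most if `d` decreases at rate at most `k < 1`
  -- over an initial length `r`.
  obtain ⟨y, hyL, hy⟩ : ∃ y ∈ L, edist x y < ENNReal.ofReal (d x + (1 - k) * r) := by
    rw [← Metric.infEDist_lt_iff, ← hd.eq_infEDist _ hx]
    exact ENNReal.ofReal_lt_ofReal_iff'.2 ⟨by nlinarith, by nlinarith⟩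
  obtain ⟨γ, hγ0, hγ1, hγ, hlen⟩ := exists_path_of_edist_lt (n := n) hy
  have hyW : ENNReal.ofReal r ≤ edist x (γ 1) := by
    by_contra! h
    rw [hγ1] at h
    exact hd.disjoint.ne_of_mem (hcl y h.le).1 (subset_closure hyL) rfl
  have hcont : ContinuousOn (fun t ↦ edist x (γ t)) (Icc 0 1) :=
    (continuous_const.edist continuous_id).comp_continuousOn hγ.continuousOn
  have hclosed : IsClosed (Icc (0 : ℝ) 1 ∩ {t | edist x (γ t) ∈ Ici (ENNReal.ofReal r)}) :=
    hcont.preimage_isClosed_of_isClosed isClosed_Icc isClosed_Ici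
  -- `t₁` is the first time at distance at least `r` from `x`; up to then the path lies in `W`,
  -- where the gradient bound holds.
  obtain ⟨t₁, ⟨ht₁, hrt₁⟩, hmin⟩ := (isCompact_Icc.of_isClosed_subset hclosed
    inter_subset_left).exists_isLeast ⟨1, ⟨zero_le_one, le_rfl⟩, hyW⟩
  have hbefore : ∀ t ∈ Icc 0 t₁, edist x (γ t) ≤ ENNReal.ofReal r := by
    rcases ht₁.1.eq_or_lt with h0 | h0
    · intro t ht
      rw [← h0, Icc_self, mem_singleton_iff] at ht
      simp [ht, hγ0]
    have hC : IsClosed (Icc 0 t₁ ∩ {t | edist x (γ t) ∈ Iic (ENNReal.ofReal r)}) :=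
      (hcont.mono (Icc_subset_Icc_right ht₁.2)).preimage_isClosed_of_isClosed isClosed_Icc
        isClosed_Iic
    have hIco : Ico 0 t₁ ⊆ Icc 0 t₁ ∩ {t | edist x (γ t) ∈ Iic (ENNReal.ofReal r)} := by
      refine fun t ht ↦ ⟨Ico_subset_Icc_self ht, ?_⟩
      by_contra h
      simp only [mem_ofPred_eq, mem_Iic, not_le] at h
      exact absurd (hmin ⟨⟨ht.1, ht.2.le.trans ht₁.2⟩, h.le⟩) (not_le.2 ht.2)
    have hcls := closure_minimal hIco hC
    rw [closure_Ico h0.ne] at hcls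
    exact fun t ht ↦ (hcls ht).2
  have hsub₁ : Icc 0 t₁ ⊆ Icc (0 : ℝ) 1 := Icc_subset_Icc_right ht₁.2
  have hsub₂ : Icc t₁ 1 ⊆ Icc (0 : ℝ) 1 := Icc_subset_Icc_left ht₁.1
  have h1 : ENNReal.ofReal r ≤ pathELength (𝓡 n) γ 0 t₁ := by
    refine le_trans hrt₁ ?_
    nth_rewrite 1 [← hγ0]
    exact edist_le_pathELength (n := n) ht₁.1 (hγ.mono hsub₁)
  have hz := hcl _ (hbefore t₁ ⟨ht₁.1, le_rfl⟩)
  have h2 : ENNReal.ofReal (d (γ t₁)) ≤ pathELength (𝓡 n) γ t₁ 1 := by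
    rw [hd.eq_infEDist _ hz.1]
    refine (Metric.infEDist_le_edist_of_mem hyL).trans ?_
    nth_rewrite 1 [← hγ1]
    exact edist_le_pathELength (n := n) ht₁.2 (hγ.mono hsub₂)
  have h3 := enorm_sub_le_mul_pathELength (W := W) (k := k.toNNReal) (fun y hy ↦ hy.2.1)
    (fun y hy ↦ by rw [← ofReal_norm]; exact ENNReal.ofReal_le_ofReal hy.2.2.le) ht₁.1
    (hγ.mono hsub₁) (fun t ht ↦ hcl _ (hbefore t ht))
  rw [← pathELength_add ht₁.1 ht₁.2] at hlen
  have hfin := (hlen.trans_le le_top).ne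
  rw [ENNReal.add_ne_top] at hfin
  obtain ⟨l₁, hl₁, hl₁'⟩ : ∃ l : ℝ, 0 ≤ l ∧ pathELength (𝓡 n) γ 0 t₁ = ENNReal.ofReal l :=
    ⟨_, ENNReal.toReal_nonneg, (ENNReal.ofReal_toReal hfin.1).symm⟩
  obtain ⟨l₂, hl₂, hl₂'⟩ : ∃ l : ℝ, 0 ≤ l ∧ pathELength (𝓡 n) γ t₁ 1 = ENNReal.ofReal l :=
    ⟨_, ENNReal.toReal_nonneg, (ENNReal.ofReal_toReal hfin.2).symm⟩
  rw [hl₁'] at h1 h3 hlen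
  rw [hl₂'] at h2 hlen
  rw [← ENNReal.ofReal_add hl₁ hl₂, ENNReal.ofReal_lt_ofReal_iff'] at hlen
  rw [ENNReal.ofReal_le_ofReal_iff hl₁] at h1
  rw [ENNReal.ofReal_le_ofReal_iff hl₂] at h2
  have h4 : |d (γ t₁) - d x| ≤ k * l₁ := by
    rw [hγ0, ← ofReal_norm, Real.norm_eq_abs] at h3
    refine (ENNReal.ofReal_le_ofReal_iff (by positivity)).1 (h3.trans_eq ?_)
    rw [ENNReal.ofReal_mul hk0]
    rfl
  have h5 := (abs_le.1 h4).1
  -- `l₁ + l₂ ≥ l₁ + d x - k l₁ ≥ d x + (1 - k) r`, against the choice of `y` and of the path.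
  nlinarith [hlen.1]

end Distance

/-! ### The profile integral -/

section Profile

/-- The function `s ↦ ∫_{s₀}^s dσ / (C ρ(σ))`. -/
def profile (ρ : ℝ → ℝ) (C s₀ s : ℝ) : ℝ := ∫ σ in s₀..s, 1 / (C * ρ σ)

variable {I : Set ℝ} (hIo : IsOpen I) (hIc : I.OrdConnected) {ρ : ℝ → ℝ}
  (hρ : ContDiffOn ℝ ∞ ρ I) (hρpos : ∀ t ∈ I, 0 < ρ t) {C : ℝ} (hC : 0 < C)
include hρ hρpos hC

theorem contDiffOn_profile_integrand : ContDiffOn ℝ ∞ (fun σ ↦ 1 / (C * ρ σ)) I :=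
  contDiffOn_const.div (contDiffOn_const.mul hρ) fun t ht ↦ (mul_pos hC (hρpos t ht)).ne'

include hIc in
theorem intervalIntegrable_profile_integrand {a b : ℝ} (ha : a ∈ I) (hb : b ∈ I) :
    IntervalIntegrable (fun σ ↦ 1 / (C * ρ σ)) MeasureTheory.volume a b :=
  ((contDiffOn_profile_integrand hρ hρpos hC).continuousOn.mono
    (hIc.uIcc_subset ha hb)).intervalIntegrable

include hIc in
-- Moving the base point changes the profile by a constant; this absorbs the shift `δ` between `u`
-- and the distance.
theorem profile_add_profile {s₀ s₁ s : ℝ} (h₀ : s₀ ∈ I) (h₁ : s₁ ∈ I) (hs : s ∈ I) :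
    profile ρ C s₀ s₁ + profile ρ C s₁ s = profile ρ C s₀ s :=
  intervalIntegral.integral_add_adjacent_intervals
    (intervalIntegrable_profile_integrand hIc hρ hρpos hC h₀ h₁)
    (intervalIntegrable_profile_integrand hIc hρ hρpos hC h₁ hs)

include hIo hIc

theorem hasDerivAt_profile {s₀ s : ℝ} (h₀ : s₀ ∈ I) (hs : s ∈ I) :
    HasDerivAt (profile ρ C s₀) (1 / (C * ρ s)) s := by
  have hc := (contDiffOn_profile_integrand hρ hρpos hC).continuousOn
  exact intervalIntegral.integral_hasDerivAt_right
    (intervalIntegrable_profile_integrand hIc hρ hρpos hC h₀ hs)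
    (hc.stronglyMeasurableAtFilter hIo s hs) (hc.continuousAt (hIo.mem_nhds hs))

theorem contDiffOn_profile {s₀ : ℝ} (h₀ : s₀ ∈ I) : ContDiffOn ℝ ∞ (profile ρ C s₀) I := by
  have hder := fun s hs ↦ hasDerivAt_profile hIo hIc hρ hρpos hC (s₀ := s₀) (s := s) h₀ hs
  refine (contDiffOn_infty_iff_deriv_of_isOpen hIo).2
    ⟨fun s hs ↦ (hder s hs).differentiableAt.differentiableWithinAt, ?_⟩
  exact (contDiffOn_profile_integrand hρ hρpos hC).congr fun s hs ↦ (hder s hs).deriv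

theorem strictMonoOn_profile {s₀ : ℝ} (h₀ : s₀ ∈ I) : StrictMonoOn (profile ρ C s₀) I := by
  refine strictMonoOn_of_deriv_pos hIc.convex
    (contDiffOn_profile hIo hIc hρ hρpos hC h₀).continuousOn fun s hs ↦ ?_
  have hs' := interior_subset hs
  rw [(hasDerivAt_profile hIo hIc hρ hρpos hC h₀ hs').deriv]
  have := hρpos s hs'
  positivity

theorem isInverseProfile_invFunOn {s₀ : ℝ} (h₀ : s₀ ∈ I) :
    IsInverseProfile I ρ C s₀ (Function.invFunOn (profile ρ C s₀) I) :=
  ⟨(strictMonoOn_profile hIo hIc hρ hρpos hC h₀).injOn.leftInvOn_invFunOn,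
    (surjOn_image _ _).rightInvOn_invFunOn⟩

/-- Small negative numbers are values of the profile function. -/
theorem exists_profile_eq_neg {s₁ : ℝ} (h₁ : s₁ ∈ I) :
    ∃ δ₀ > 0, ∀ δ ∈ Ioo 0 δ₀, ∃ s₀ ∈ I, profile ρ C s₁ s₀ = -δ := by
  obtain ⟨a, ha1, ha⟩ : ∃ a < s₁, a ∈ I := by
    obtain ⟨l, hl, hlI⟩ := exists_Ioc_subset_of_mem_nhds (hIo.mem_nhds h₁) ⟨s₁ - 1, by linarith⟩
    exact ⟨(l + s₁) / 2, by linarith, hlI ⟨by linarith, by linarith⟩⟩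
  have h0 : profile ρ C s₁ s₁ = 0 := intervalIntegral.integral_same
  have hlt := strictMonoOn_profile hIo hIc hρ hρpos hC h₁ ha h₁ ha1
  rw [h0] at hlt
  refine ⟨-profile ρ C s₁ a, by linarith, fun δ hδ ↦ ?_⟩
  have hsub : Icc a s₁ ⊆ I := hIc.out ha h₁
  obtain ⟨s₀, hs₀, h⟩ := intermediate_value_Icc ha1.le
    ((contDiffOn_profile hIo hIc hρ hρpos hC h₁).continuousOn.mono hsub)
    (show -δ ∈ Icc (profile ρ C s₁ a) (profile ρ C s₁ s₁) from
      ⟨by linarith [hδ.2], by rw [h0]; linarith [hδ.1]⟩)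
  exact ⟨s₀, hsub hs₀, h⟩

end Profile

/-! ### Hypersurfaces of the product and fields along them -/

section Hypersurface

variable {n : ℕ} {P : Type*} [TopologicalSpace P] [ChartedSpace (EuclideanSpace ℝ (Fin n)) P]
  [IsManifold (𝓡 n) ∞ P]
  {M : Type*} [TopologicalSpace M] [ChartedSpace (EuclideanSpace ℝ (Fin n)) M]
  {I : Set ℝ} {F : M → ℝ × P}

omit [IsManifold (𝓡 n) ∞ P] in
theorem IsImmersedHypersurface.contMDiff_fst (hF : IsImmersedHypersurface (n := n) I F) :
    ContMDiff (𝓡 n) 𝓘(ℝ, ℝ) ∞ (fun q ↦ (F q).1) :=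
  _root_.contMDiff_fst.comp hF.smooth

omit [IsManifold (𝓡 n) ∞ P] in
theorem IsImmersedHypersurface.contMDiff_snd (hF : IsImmersedHypersurface (n := n) I F) :
    ContMDiff (𝓡 n) (𝓡 n) ∞ (fun q ↦ (F q).2) :=
  _root_.contMDiff_snd.comp hF.smooth

theorem IsImmersedHypersurface.timePart_mfderiv (hF : IsImmersedHypersurface (n := n) I F) (q : M)
    (v : TangentSpace (𝓡 n) q) :
    timePart (mfderiv (𝓡 n) (𝓘(ℝ, ℝ).prod (𝓡 n)) F q v) =
      (show ℝ from mfderiv (𝓡 n) 𝓘(ℝ, ℝ) (fun q ↦ (F q).1) q v) := by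
  rw [← timePart_eq_mfderiv]
  have := mfderiv_comp (I' := 𝓘(ℝ, ℝ).prod (𝓡 n)) (I'' := 𝓘(ℝ, ℝ)) q (g := Prod.fst) (f := F)
    mdifferentiableAt_fst (hF.smooth.mdifferentiable (by simp) q)
  exact (congrArg (fun L ↦ L v) this).symm

theorem IsImmersedHypersurface.spacePart_mfderiv (hF : IsImmersedHypersurface (n := n) I F) (q : M)
    (v : TangentSpace (𝓡 n) q) :
    spacePart (mfderiv (𝓡 n) (𝓘(ℝ, ℝ).prod (𝓡 n)) F q v) =
      mfderiv (𝓡 n) (𝓡 n) (fun q ↦ (F q).2) q v := by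
  rw [← spacePart_eq_mfderiv]
  have := mfderiv_comp (I' := 𝓘(ℝ, ℝ).prod (𝓡 n)) (I'' := 𝓡 n) q (g := Prod.snd) (f := F)
    mdifferentiableAt_snd (hF.smooth.mdifferentiable (by simp) q)
  exact (congrArg (fun L ↦ L v) this).symm

/-- If the time component of the differential of an immersed hypersurface vanishes on the kernel
of the space component, the latter is injective. -/
theorem IsImmersedHypersurface.injective_mfderiv_snd (hF : IsImmersedHypersurface (n := n) I F)
    {q : M} (h : ∀ v : TangentSpace (𝓡 n) q, mfderiv (𝓡 n) (𝓡 n) (fun q ↦ (F q).2) q v = 0 →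
      timePart (mfderiv (𝓡 n) (𝓘(ℝ, ℝ).prod (𝓡 n)) F q v) = 0) :
    Function.Injective (mfderiv (𝓡 n) (𝓡 n) (fun q ↦ (F q).2) q) := by
  rw [injective_iff_map_eq_zero]
  intro v hv
  apply (injective_iff_map_eq_zero _).1 (hF.injective_mfderiv q)
  have h2 := hF.spacePart_mfderiv q v
  rw [hv] at h2
  exact Prod.ext (h v hv) h2

/-- If `u = G(t)` along the hypersurface, then `du = G'(t) dt` on its tangent vectors. -/
theorem IsImmersedHypersurface.inner_riemGrad_eq
    [RiemannianBundle (fun p : P ↦ TangentSpace (𝓡 n) p)]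
    (hF : IsImmersedHypersurface (n := n) I F) {q : M} {u : P → ℝ} {G : ℝ → ℝ} {g' : ℝ}
    (hu : MDifferentiableAt (𝓡 n) 𝓘(ℝ, ℝ) u (F q).2) (hG : HasDerivAt G g' (F q).1)
    (h : (fun z ↦ u (F z).2) =ᶠ[𝓝 q] fun z ↦ G (F z).1) (v : TangentSpace (𝓡 n) q) :
    inner ℝ (riemGrad n u (F q).2) (mfderiv (𝓡 n) (𝓡 n) (fun q ↦ (F q).2) q v) =
      g' * timePart (mfderiv (𝓡 n) (𝓘(ℝ, ℝ).prod (𝓡 n)) F q v) := by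
  rw [inner_riemGrad, hF.timePart_mfderiv]
  have h1 := mfderiv_comp (I' := 𝓡 n) q hu (hF.contMDiff_snd.mdifferentiable (by simp) q)
  have h2 := (hG.hasFDerivAt.hasMFDerivAt.comp q
    (hF.contMDiff_fst.mdifferentiable (by simp) q).hasMFDerivAt).mfderiv
  have h3 : mfderiv (𝓡 n) 𝓘(ℝ, ℝ) (u ∘ fun q ↦ (F q).2) q =
      mfderiv (𝓡 n) 𝓘(ℝ, ℝ) (G ∘ fun q ↦ (F q).1) q := h.mfderiv_eq
  have h4 := congrArg (fun L ↦ L v) (h1.symm.trans (h3.trans h2))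
  refine h4.trans ?_
  rw [mul_comm]
  rfl

omit [IsManifold (𝓡 n) ∞ P] in
theorem surjective_of_injective_mfderiv {p : M → P} {q : M}
    (h : Function.Injective (mfderiv (𝓡 n) (𝓡 n) p q)) :
    Function.Surjective (mfderiv (𝓡 n) (𝓡 n) p q) :=
  LinearMap.surjective_of_injective (f := (show EuclideanSpace ℝ (Fin n) →L[ℝ]
    EuclideanSpace ℝ (Fin n) from mfderiv (𝓡 n) (𝓡 n) p q).toLinearMap) h

/-- The product of a continuous function and a continuous field along a map is continuous. -/
theorem continuousAt_smul_field {X : Type*} [TopologicalSpace X] {p : X → P}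
    {w : ∀ q, TangentSpace (𝓡 n) (p q)} {c : X → ℝ} {q : X} (hc : ContinuousAt c q)
    (hw : ContinuousAt (fun q ↦ (⟨p q, w q⟩ : TangentBundle (𝓡 n) P)) q) :
    ContinuousAt (fun q ↦ (⟨p q, c q • w q⟩ : TangentBundle (𝓡 n) P)) q := by
  rw [FiberBundle.continuousAt_totalSpace] at hw ⊢
  refine ⟨hw.1, (hc.smul hw.2).congr ?_⟩
  filter_upwards [hw.1.preimage_mem_nhds ((trivializationAt (EuclideanSpace ℝ (Fin n))
    (TangentSpace (𝓡 n)) (p q)).open_baseSet.mem_nhds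
      (FiberBundle.mem_baseSet_trivializationAt' (p q)))] with x hx
  exact (((trivializationAt (EuclideanSpace ℝ (Fin n))
    (TangentSpace (𝓡 n)) (p q)).linear ℝ hx).map_smul (c x) (w x)).symm

/-- A field along a map into `ℝ × P` with constant time component is continuous if its space
component is. -/
theorem continuousAt_prod_field {X : Type*} [TopologicalSpace X] {F : X → ℝ × P} {q : X} {a : ℝ}
    {w : ∀ q, TangentSpace (𝓡 n) (F q).2} (hF : ContinuousAt F q)
    (hw : ContinuousAt (fun q ↦ (⟨(F q).2, w q⟩ : TangentBundle (𝓡 n) P)) q) :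
    ContinuousAt (fun q ↦ (⟨F q, (show TangentSpace (𝓘(ℝ, ℝ).prod (𝓡 n)) (F q) from (a, w q))⟩ :
      TangentBundle (𝓘(ℝ, ℝ).prod (𝓡 n)) (ℝ × P))) q := by
  have h1 : ContinuousAt (fun q ↦ (⟨(F q).1, a⟩ : TangentBundle 𝓘(ℝ, ℝ) ℝ)) q := by
    rw [← (tangentBundleModelSpaceHomeomorph 𝓘(ℝ, ℝ)).comp_continuousAt_iff]
    exact hF.fst.prodMk continuousAt_const
  exact ((contMDiff_equivTangentBundleProd_symm (n := 0) (I := 𝓘(ℝ, ℝ)) (I' := 𝓡 n) (M := ℝ)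
    (M' := P)).continuous.continuousAt).comp (h1.prodMk hw)

end Hypersurface

/-! ### The two implications -/

section Main

variable {n : ℕ} {P : Type*} [EMetricSpace P] [ChartedSpace (EuclideanSpace ℝ (Fin n)) P]
  [RiemannianBundle (fun p : P ↦ TangentSpace (𝓡 n) p)]
  {M : Type*} [TopologicalSpace M] [ChartedSpace (EuclideanSpace ℝ (Fin n)) M]
  [IsManifold (𝓡 n) ∞ M]
  {I : Set ℝ} {ρ : ℝ → ℝ} {F : M → ℝ × P} {θ : ℝ}

theorem warpedInner_dt (ρ : ℝ → ℝ) (x : ℝ × P) (v : TangentSpace (𝓘(ℝ, ℝ).prod (𝓡 n)) x) :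
    warpedInner ρ x (dt x) v = timePart v := by
  have h1 : timePart (dt x : TangentSpace (𝓘(ℝ, ℝ).prod (𝓡 n)) x) = 1 := rfl
  have h2 : spacePart (dt x : TangentSpace (𝓘(ℝ, ℝ).prod (𝓡 n)) x) = 0 := rfl
  rw [warpedInner, h1, h2, inner_zero_left]
  ring

theorem warpedAngle_dt {ρ : ℝ → ℝ} {x : ℝ × P} {v : TangentSpace (𝓘(ℝ, ℝ).prod (𝓡 n)) x}
    (hv : warpedInner ρ x v v = 1) : warpedAngle ρ x (dt x) v = Real.arccos (timePart v) := by
  rw [warpedAngle, hv, warpedInner_dt, warpedInner_dt]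
  have h1 : timePart (dt x : TangentSpace (𝓘(ℝ, ℝ).prod (𝓡 n)) x) = 1 := rfl
  rw [h1]
  simp

/-- A unit vector which makes the angle `θ` with `∂_t` has time component `cos θ`. -/
theorem timePart_eq_cos {x : ℝ × P} {v : TangentSpace (𝓘(ℝ, ℝ).prod (𝓡 n)) x}
    (hv : warpedInner ρ x v v = 1) (h : warpedAngle ρ x (dt x) v = θ) :
    timePart v = Real.cos θ := by
  rw [warpedAngle_dt hv] at h
  -- `Real.arccos` is constant outside `[-1, 1]`, so this bound is needed before applying `cos`.
  have h1 : timePart v * timePart v ≤ 1 := by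
    have h2 : 0 ≤ ρ x.1 ^ 2 * inner ℝ (spacePart v) (spacePart v) :=
      mul_nonneg (sq_nonneg _) real_inner_self_nonneg
    rw [warpedInner] at hv
    linarith
  rw [← h, Real.cos_arccos (by nlinarith) (by nlinarith)]

variable [IsManifold (𝓡 n) ∞ P]
  [IsContMDiffRiemannianBundle (𝓡 n) ∞ (EuclideanSpace ℝ (Fin n))
      (fun p : P ↦ TangentSpace (𝓡 n) p)]
  [IsRiemannianManifold (𝓡 n) P]

/-- A constant angle hypersurface is locally the graph of a function of a distance. -/
theorem IsConstantAngleHypersurface.isLocallyDistanceGraph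
    (hIo : IsOpen I) (hIc : I.OrdConnected)
    (hρ : ContDiffOn ℝ ∞ ρ I) (hρpos : ∀ t ∈ I, 0 < ρ t)
    (hF : IsImmersedHypersurface (n := n) I F) (hθ : θ ∈ Ioo 0 (Real.pi / 2))
    (h : IsConstantAngleHypersurface (n := n) ρ F θ) :
    IsLocallyDistanceGraph (n := n) I ρ (Real.tan θ) F := by
  obtain ⟨ξ, hξ, hangle⟩ := h
  have hcos : 0 < Real.cos θ := Real.cos_pos_of_mem_Ioo ⟨by linarith [hθ.1, Real.pi_pos], hθ.2⟩
  have hsin : 0 < Real.sin θ := Real.sin_pos_of_mem_Ioo ⟨hθ.1, by linarith [hθ.2, Real.pi_pos]⟩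
  have hC : 0 < Real.tan θ := Real.tan_pos_of_pos_of_lt_pi_div_two hθ.1 hθ.2
  have hCcos : Real.tan θ * Real.cos θ = Real.sin θ := Real.tan_mul_cos hcos.ne'
  have htime : ∀ q, timePart (ξ q) = Real.cos θ := fun q ↦ timePart_eq_cos (hξ.unit q) (hangle q)
  have hnormal : ∀ q (v : TangentSpace (𝓡 n) q),
      Real.cos θ * timePart (mfderiv (𝓡 n) (𝓘(ℝ, ℝ).prod (𝓡 n)) F q v) + ρ (F q).1 ^ 2 *
        inner ℝ (spacePart (ξ q)) (mfderiv (𝓡 n) (𝓡 n) (fun q ↦ (F q).2) q v) = 0 := by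
    intro q v
    have := hξ.normal q v
    rwa [warpedInner, htime, hF.spacePart_mfderiv] at this
  have hspace : ∀ q, ρ (F q).1 * ‖spacePart (ξ q)‖ = Real.sin θ := by
    intro q
    have h1 := hξ.unit q
    rw [warpedInner, htime, real_inner_self_eq_norm_sq] at h1
    have h2 := Real.sin_sq_add_cos_sq θ
    have h3 := hρpos _ (hF.mem q)
    rw [← abs_of_pos hsin, ← abs_of_nonneg (mul_nonneg h3.le (norm_nonneg _)),
      ← sq_eq_sq_iff_abs_eq_abs]
    linarith [mul_pow (ρ (F q).1) ‖spacePart (ξ q)‖ 2]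
  have hinj : ∀ q, Function.Injective (mfderiv (𝓡 n) (𝓡 n) (fun q ↦ (F q).2) q) := by
    intro q
    refine hF.injective_mfderiv_snd fun v hv ↦ ?_
    have h1 := hnormal q v
    rw [hv, inner_zero_right, mul_zero, add_zero] at h1
    exact (mul_eq_zero.1 h1).resolve_left hcos.ne'
  intro q
  obtain ⟨e, hqe, hep, hes⟩ :=
    exists_openPartialHomeomorph_of_injective_mfderiv hF.contMDiff_snd hinj q
  have hright : ∀ y ∈ e.target, (F (e.symm y)).2 = y := fun y hy ↦ by
    rw [← hep _ (e.map_target hy), e.right_inv hy]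
  have hleft : ∀ q' ∈ e.source, e.symm (F q').2 = q' := fun q' hq' ↦ by
    rw [← hep _ hq', e.left_inv hq']
  have hmap : ∀ q' ∈ e.source, (F q').2 ∈ e.target := fun q' hq' ↦ hep _ hq' ▸ e.map_source hq'
  -- Basing the profile at the height of `q` makes `u` vanish at the projection of `q`.
  set s₁ := (F q).1 with hs₁
  have hs₁I : s₁ ∈ I := hF.mem q
  set G := profile ρ (Real.tan θ) s₁ with hG
  set u : P → ℝ := fun y ↦ G (F (e.symm y)).1 with hu
  have hGs : ∀ t ∈ I, ContDiffAt ℝ ∞ G t := fun t ht ↦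
    (contDiffOn_profile hIo hIc hρ hρpos hC hs₁I).contDiffAt (hIo.mem_nhds ht)
  have hus : ContMDiffOn (𝓡 n) 𝓘(ℝ, ℝ) ∞ u e.target := by
    intro y hy
    exact (hGs _ (hF.mem (e.symm y))).contMDiffAt.comp_contMDiffWithinAt y
      ((hF.contMDiff_fst.contMDiffAt).comp_contMDiffWithinAt y (hes y hy))
  have hgrad : ∀ q' ∈ e.source, ‖riemGrad n u (F q').2‖ = 1 := by
    intro q' hq'
    have hρ' := hρpos _ (hF.mem q')
    -- Since the projection has surjective differential, it suffices to test on tangent vectors of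
    -- `M`, where `du = dt / (C ρ)` and normality expresses `dt` through `spacePart (ξ q')`.
    have key : riemGrad n u (F q').2 = -(ρ (F q').1 / Real.sin θ) • spacePart (ξ q') := by
      refine ext_inner_right ℝ fun w ↦ ?_
      obtain ⟨v, rfl⟩ := surjective_of_injective_mfderiv (hinj q') w
      have hud := (hus.contMDiffAt (e.open_target.mem_nhds (hmap q' hq'))).mdifferentiableAt
        (by simp)
      rw [hF.inner_riemGrad_eq hud
        (hasDerivAt_profile hIo hIc hρ hρpos hC hs₁I (hF.mem q')) ?_]
      · have hn := hnormal q' v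
        rw [inner_smul_left]
        simp only [conj_trivial]
        rw [← hCcos]
        field_simp
        linarith
      · filter_upwards [e.open_source.mem_nhds hq'] with z hz
        simp only [hu, hleft z hz]
        rfl
    rw [key, norm_smul, norm_neg, Real.norm_of_nonneg (by positivity), div_mul_eq_mul_div,
      hspace, div_self hsin.ne']
  obtain ⟨δ₀, hδ₀, hδ⟩ := exists_profile_eq_neg hIo hIc hρ hρpos hC hs₁I
  obtain ⟨δ, hδm, U, L, hqU, hUe, hL, hd⟩ := exists_isDistanceToOn e.open_target (hmap q hqe) hus
    (fun y hy ↦ by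
      rw [← hright y hy]
      exact hgrad _ (e.map_target hy))
    (by simp only [hu, hleft q hqe, hG]; exact intervalIntegral.integral_same) hδ₀
  -- With this base point the profile from `s₀` is `G + δ`, so it equals the distance `u + δ` along
  -- the graph.
  obtain ⟨s₀, hs₀, hs₀δ⟩ := hδ δ hδm
  have hadd : ∀ t ∈ I, G t + δ = profile ρ (Real.tan θ) s₀ t := fun t ht ↦ by
    rw [hG, ← profile_add_profile hIc hρ hρpos hC hs₁I hs₀ ht, hs₀δ]
    ring
  have hinv := isInverseProfile_invFunOn hIo hIc hρ hρpos hC hs₀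
  set g := Function.invFunOn (profile ρ (Real.tan θ) s₀) I with hg
  have hval : ∀ q', g (profile ρ (Real.tan θ) s₀ (F q').1) = (F q').1 := fun q' ↦
    hinv.1 (hF.mem q')
  refine ⟨e.source ∩ e ⁻¹' U, U, L, s₀, fun x ↦ u x + δ, g, e.isOpen_inter_preimage hd.isOpen,
    ⟨hqe, by rw [mem_preimage, hep q hqe]; exact hqU⟩, hL, hd, hs₀, hinv, ?_, ?_, ?_, ?_⟩
  · intro x hx
    exact ⟨(F (e.symm x)).1, hF.mem _, (hadd _ (hF.mem _)).symm⟩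
  · rintro q' ⟨hq', hq'U⟩
    rw [mem_preimage, hep q' hq'] at hq'U
    refine ⟨hq'U, ?_⟩
    simp only [Function.comp_apply, hu, hleft q' hq']
    rw [hadd _ (hF.mem q'), hval]
  · intro q' hq' q'' hq'' heq
    apply e.injOn hq'.1 hq''.1
    rw [hep _ hq'.1, hep _ hq''.1, heq]
  · rintro ⟨t, x⟩ ⟨hxU, ht⟩
    have hxe := hUe hxU
    refine ⟨e.symm x, ⟨e.map_target hxe, by rwa [mem_preimage, e.right_inv hxe]⟩, ?_⟩
    refine Prod.ext ?_ (hright x hxe)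
    simp only [Function.comp_apply, hu] at ht
    rw [ht, hadd _ (hF.mem _), hval]

/-- Locally along a distance graph, `d(d) = (C ρ)⁻¹ dt` on tangent vectors, for a smooth function
`d` with unit gradient; moreover the graph projects immersively to `P`. -/
theorem IsLocallyDistanceGraph.exists_unit_riemGrad {C : ℝ} (hC : 0 < C)
    (hIo : IsOpen I) (hIc : I.OrdConnected)
    (hρ : ContDiffOn ℝ ∞ ρ I) (hρpos : ∀ t ∈ I, 0 < ρ t)
    (hF : IsImmersedHypersurface (n := n) I F) (h : IsLocallyDistanceGraph (n := n) I ρ C F) :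
    (∀ q, Function.Injective (mfderiv (𝓡 n) (𝓡 n) (fun q ↦ (F q).2) q)) ∧
    ∀ q : M, ∃ (V : Set M) (d : P → ℝ), IsOpen V ∧ q ∈ V ∧ ∀ q' ∈ V,
      ContMDiffAt (𝓡 n) 𝓘(ℝ, ℝ) ∞ d (F q').2 ∧ ‖riemGrad n d (F q').2‖ = 1 ∧
      ∀ v : TangentSpace (𝓡 n) q',
        inner ℝ (riemGrad n d (F q').2) (mfderiv (𝓡 n) (𝓡 n) (fun q ↦ (F q).2) q' v) =
          1 / (C * ρ (F q').1) * timePart (mfderiv (𝓡 n) (𝓘(ℝ, ℝ).prod (𝓡 n)) F q' v) := by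
  have hlocal : ∀ q : M, ∃ (V : Set M) (U L : Set P) (s₀ : ℝ) (d : P → ℝ), IsOpen V ∧ q ∈ V ∧
      s₀ ∈ I ∧ IsDistanceToOn (n := n) d L U ∧
      ∀ q' ∈ V, (F q').2 ∈ U ∧ d (F q').2 = profile ρ C s₀ (F q').1 := by
    intro q
    obtain ⟨V, U, L, s₀, d, g, hV, hqV, -, hd, hs₀, hg, hval, hbij⟩ := h q
    refine ⟨V, U, L, s₀, d, hV, hqV, hs₀, hd, fun q' hq' ↦ ?_⟩
    obtain ⟨h1, h2⟩ := hbij.mapsTo hq'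
    refine ⟨h1, ?_⟩
    rw [h2]
    exact (hg.2 (hval _ h1)).symm
  have hdiff : ∀ {V : Set M} {U L : Set P} {s₀ : ℝ} {d : P → ℝ}, IsOpen V → s₀ ∈ I →
      IsDistanceToOn (n := n) d L U →
      (∀ q' ∈ V, (F q').2 ∈ U ∧ d (F q').2 = profile ρ C s₀ (F q').1) →
      ∀ q' ∈ V, ∀ v : TangentSpace (𝓡 n) q',
        inner ℝ (riemGrad n d (F q').2) (mfderiv (𝓡 n) (𝓡 n) (fun q ↦ (F q).2) q' v) =
          1 / (C * ρ (F q').1) * timePart (mfderiv (𝓡 n) (𝓘(ℝ, ℝ).prod (𝓡 n)) F q' v) := by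
    intro V U L s₀ d hV hs₀ hd hVd q' hq' v
    refine hF.inner_riemGrad_eq (hd.differentiable _ (hVd q' hq').1)
      (hasDerivAt_profile hIo hIc hρ hρpos hC hs₀ (hF.mem q')) ?_ v
    filter_upwards [hV.mem_nhds hq'] with z hz using (hVd z hz).2
  have hinj : ∀ q, Function.Injective (mfderiv (𝓡 n) (𝓡 n) (fun q ↦ (F q).2) q) := by
    intro q
    obtain ⟨V, U, L, s₀, d, hV, hqV, hs₀, hd, hVd⟩ := hlocal q
    refine hF.injective_mfderiv_snd fun v hv ↦ ?_
    have h1 := hdiff hV hs₀ hd hVd q hqV v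
    rw [hv, inner_zero_right] at h1
    have h2 : 0 < 1 / (C * ρ (F q).1) := by
      have := hρpos _ (hF.mem q)
      positivity
    exact (mul_eq_zero.1 h1.symm).resolve_left h2.ne'
  refine ⟨hinj, fun q ↦ ?_⟩
  obtain ⟨V, U, L, s₀, d, hV, hqV, hs₀, hd, hVd⟩ := hlocal q
  refine ⟨V, d, hV, hqV, fun q' hq' ↦ ?_⟩
  -- Near the point, `d` is the profile of the height composed with the local inverse of the
  -- projection, hence smooth.
  have hsm : ContMDiffAt (𝓡 n) 𝓘(ℝ, ℝ) ∞ d (F q').2 := by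
    obtain ⟨e, hqe, hep, hes⟩ :=
      exists_openPartialHomeomorph_of_injective_mfderiv hF.contMDiff_snd hinj q'
    have hy : (F q').2 ∈ e.target := hep _ hqe ▸ e.map_source hqe
    have hq'e : e.symm (F q').2 = q' := by rw [← hep _ hqe, e.left_inv hqe]
    have hσ : ContMDiffAt (𝓡 n) (𝓡 n) ∞ e.symm (F q').2 :=
      hes.contMDiffAt (e.open_target.mem_nhds hy)
    have hG : ContDiffAt ℝ ∞ (profile ρ C s₀) (F (e.symm (F q').2)).1 :=
      (contDiffOn_profile hIo hIc hρ hρpos hC hs₀).contDiffAt (hIo.mem_nhds (hF.mem _))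
    refine (hG.contMDiffAt.comp (F q').2
      (hF.contMDiff_fst.contMDiffAt.comp (F q').2 hσ)).congr_of_eventuallyEq ?_
    filter_upwards [e.open_target.mem_nhds hy,
      hσ.continuousAt.preimage_mem_nhds (by rw [hq'e]; exact hV.mem_nhds hq')] with y hy1 hy2
    have hy3 : (F (e.symm y)).2 = y := by rw [← hep _ (e.map_target hy1), e.right_inv hy1]
    have := (hVd _ hy2).2
    rw [hy3] at this
    exact this
  exact ⟨hsm, le_antisymm (norm_riemGrad_le_one_of_isDistanceToOn hd (hVd q' hq').1 hsm)
    (one_le_norm_riemGrad_of_isDistanceToOn hd (hVd q' hq').1 hsm), hdiff hV hs₀ hd hVd q' hq'⟩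

/-- The graph of `h ∘ d` makes a constant angle with `∂_t`. -/
theorem IsLocallyDistanceGraph.isConstantAngleHypersurface
    (hIo : IsOpen I) (hIc : I.OrdConnected)
    (hρ : ContDiffOn ℝ ∞ ρ I) (hρpos : ∀ t ∈ I, 0 < ρ t)
    (hF : IsImmersedHypersurface (n := n) I F) (hθ : θ ∈ Ioo 0 (Real.pi / 2))
    (h : IsLocallyDistanceGraph (n := n) I ρ (Real.tan θ) F) :
    IsConstantAngleHypersurface (n := n) ρ F θ := by
  have hcos : 0 < Real.cos θ := Real.cos_pos_of_mem_Ioo ⟨by linarith [hθ.1, Real.pi_pos], hθ.2⟩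
  have hsin : 0 < Real.sin θ := Real.sin_pos_of_mem_Ioo ⟨hθ.1, by linarith [hθ.2, Real.pi_pos]⟩
  have hC : 0 < Real.tan θ := Real.tan_pos_of_pos_of_lt_pi_div_two hθ.1 hθ.2
  have hCcos : Real.tan θ * Real.cos θ = Real.sin θ := Real.tan_mul_cos hcos.ne'
  obtain ⟨hinj, hloc⟩ := h.exists_unit_riemGrad hC hIo hIc hρ hρpos hF
  -- The right side does not involve the local function `d`. As the projection has surjective
  -- differential, it determines `w`, so the local gradients glue to a global continuous field.
  have hex : ∀ q : M, ∃ w : TangentSpace (𝓡 n) (F q).2, ‖w‖ = 1 ∧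
      ∀ v : TangentSpace (𝓡 n) q,
        inner ℝ w (mfderiv (𝓡 n) (𝓡 n) (fun q ↦ (F q).2) q v) =
          1 / (Real.tan θ * ρ (F q).1) *
            timePart (mfderiv (𝓡 n) (𝓘(ℝ, ℝ).prod (𝓡 n)) F q v) := by
    intro q
    obtain ⟨V, d, -, hqV, hd⟩ := hloc q
    exact ⟨_, (hd q hqV).2⟩
  choose w hw1 hw using hex
  have hwcont : ∀ q, ContinuousAt (fun q ↦ (⟨(F q).2, w q⟩ : TangentBundle (𝓡 n) P)) q := by
    intro q
    obtain ⟨V, d, hV, hqV, hd⟩ := hloc q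
    have hc := (contMDiffAt_riemGrad (hd q hqV).1).continuousAt
    have hc' : ContinuousAt
        (fun q ↦ (⟨(F q).2, riemGrad n d (F q).2⟩ : TangentBundle (𝓡 n) P)) q :=
      ContinuousAt.comp (f := fun q ↦ (F q).2) hc (hF.contMDiff_snd.continuous.continuousAt)
    refine hc'.congr ?_
    filter_upwards [hV.mem_nhds hqV] with z hz
    have : riemGrad n d (F z).2 = w z := by
      refine ext_inner_right ℝ fun a ↦ ?_
      obtain ⟨v, rfl⟩ := surjective_of_injective_mfderiv (hinj z) a
      rw [(hd z hz).2.2, hw]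
    rw [this]
  -- This is `∇d = -(ρ / sin θ) X` solved for `X`.
  set ξ : ∀ q : M, TangentSpace (𝓘(ℝ, ℝ).prod (𝓡 n)) (F q) := fun q ↦
    (show TangentSpace (𝓘(ℝ, ℝ).prod (𝓡 n)) (F q) from
      (Real.cos θ, -(Real.sin θ / ρ (F q).1) • w q)) with hξ
  have htime : ∀ q, timePart (ξ q) = Real.cos θ := fun q ↦ rfl
  have hspace : ∀ q, spacePart (ξ q) = -(Real.sin θ / ρ (F q).1) • w q := fun q ↦ rfl
  have hunit : ∀ q, warpedInner ρ (F q) (ξ q) (ξ q) = 1 := by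
    intro q
    have := hρpos _ (hF.mem q)
    rw [warpedInner, htime, hspace, real_inner_self_eq_norm_sq, norm_smul, hw1, norm_neg,
      Real.norm_of_nonneg (by positivity), mul_one, ← Real.sin_sq_add_cos_sq θ]
    field_simp
    ring
  refine ⟨ξ, ⟨?_, hunit, ?_⟩, ?_⟩
  · rw [continuous_iff_continuousAt]
    intro q
    refine continuousAt_prod_field hF.smooth.continuous.continuousAt
      (continuousAt_smul_field ?_ (hwcont q))
    have hρc : ContinuousAt ρ (F q).1 := hρ.continuousOn.continuousAt (hIo.mem_nhds (hF.mem q))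
    exact (continuousAt_const.div (ContinuousAt.comp (f := fun q ↦ (F q).1) hρc
      hF.contMDiff_fst.continuous.continuousAt) (hρpos _ (hF.mem q)).ne').neg
  · intro q v
    have := hρpos _ (hF.mem q)
    rw [warpedInner, htime, hspace, hF.spacePart_mfderiv, inner_smul_left, hw, ← hCcos]
    simp only [conj_trivial]
    field_simp
    ring
  · intro q
    rw [warpedAngle_dt (hunit q), htime, Real.arccos_cos hθ.1.le (by linarith [hθ.2, Real.pi_pos])]

end Main

end

theorem mainTheorem2 {n : ℕ}
    {P : Type*} [EMetricSpace P] [ChartedSpace (EuclideanSpace ℝ (Fin n)) P]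
    [IsManifold (𝓡 n) ∞ P]
    [RiemannianBundle (fun p : P ↦ TangentSpace (𝓡 n) p)]
    [IsContMDiffRiemannianBundle (𝓡 n) ∞ (EuclideanSpace ℝ (Fin n))
      (fun p : P ↦ TangentSpace (𝓡 n) p)]
    [IsRiemannianManifold (𝓡 n) P]
    {M : Type*} [TopologicalSpace M] [ChartedSpace (EuclideanSpace ℝ (Fin n)) M]
    [IsManifold (𝓡 n) ∞ M] [ConnectedSpace M]
    (I : Set ℝ) (hIo : IsOpen I) (hIc : I.OrdConnected)
    (ρ : ℝ → ℝ) (hρ : ContDiffOn ℝ ∞ ρ I) (hρpos : ∀ t ∈ I, 0 < ρ t)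
    (F : M → ℝ × P) (hF : IsImmersedHypersurface (n := n) I F)
    (θ : ℝ) (hθ : θ ∈ Ioo 0 (Real.pi / 2)) :
    IsConstantAngleHypersurface (n := n) ρ F θ ↔
      IsLocallyDistanceGraph (n := n) I ρ (Real.tan θ) F :=
  ⟨fun h ↦ h.isLocallyDistanceGraph hIo hIc hρ hρpos hF hθ,
    fun h ↦ h.isConstantAngleHypersurface hIo hIc hρ hρpos hF hθ⟩
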